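/- **Setting.** Let $H_1,\dots,H_d$ be traceless Hermitian operators on $\mathbb C^D$, $U_\theta=\exp(i\sum_j\theta_jH_j)$ for $\theta\in\mathbb R^d$, and let the effective generators $H_j^{\mathrm{eff}}(\theta)$ be the first-order coefficients in $U_{-\theta}U_{\theta+\delta\theta}=\mathbb 1+i\sum_j\delta\theta_jH_j^{\mathrm{eff}}(\theta)+o(\delta\theta)$. A product probe $|\psi_1\rangle\otimes\cdots\otimes|\psi_K\rangle$ of unit vectors of $\mathbb C^D$ generates the model $\rho_\theta=|\Psi_\theta\rangle\langle\Psi_\theta|$ with $\Psi_\theta=U_\theta^{\otimes K}(\psi_1\otimes\cdots\otimes\psi_K)$. Let $L_i(\theta)$ be a symmetric logarithmic derivative (Hermitian, $\partial_i\rho_\theta=\frac12(\rho_\theta L_i+L_i\rho_\theta)$) and $$F_{ij}(\theta)=\tfrac12\operatorname{Tr}[\rho_\theta(L_iL_j+L_jL_i)],\qquad A_{ij}(\theta)=\tfrac1{2i}\operatorname{Tr}[\rho_\theta[L_i,L_j]].$$ When $F(\theta)>0$, the incompatibility measure is $$\mathcal I(\theta)=\liminf_{N\to\infty}\ \inf_{M_N}\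 \sup_{0\ne G\ge0}\frac{N\operatorname{Tr}[G\,\Sigma^{(N)}(\theta)]}{\operatorname{Tr}[G\,F^{-1}(\theta)]}\;-\;1,$$ where $M_N$ runs over the POVMs on $N$ copies $\rho_\theta^{\otimes N}$ with outcome $\hat\theta\in\mathbb R^d$ that are locally unbiased at $\theta$ (zero bias and zero first derivatives of the bias at $\theta$) and have a finite mean square error matrix $\Sigma^{(N)}(\theta)$, and $G$ over the nonzero real positive semidefinite $d\times d$ matrices. **Theorem.** 1. *(Generalized anti-parallel strategy.)* Let $d=2$, fix $\theta$ and put $C=[H_1^{\mathrm{eff}}(\theta),H_2^{\mathrm{eff}}(\theta)]$. Suppose that $a_1,\dots,a_m>0$ and that $|{+ia_j}\rangle,|{-ia_j}\rangle$ ($1\le j\le m$) form an orthonormal family with $C|{\pm ia_j}\rangle=\pm ia_j|{\pm ia_j}\rangle$. Let $\emptyset\ne\mathcal S\subseteq\{1,\dots,m\}$, $s_j\in\{0,1\}$, $\varphi^1_j,\varphi^2_j\in\mathbb R$, and let $\nu_1,\nu_2\in\ker C$ (possibly $0$) with $\|\nu_1\|=\|\nu_2\|=:\nu$. Put $$|\psi_1\rangle=\frac{1}{\sqrt{|\mathcal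 S|+\nu^2}}\Big(\sum_{j\in\mathcal S}e^{i\varphi^1_j}|i(-1)^{s_j}a_j\rangle+\nu_1\Big),\qquad |\psi_2\rangle=\frac{1}{\sqrt{|\mathcal S|+\nu^2}}\Big(\sum_{j\in\mathcal S}e^{i\varphi^2_j}|{-i(-1)^{s_j}a_j}\rangle+\nu_2\Big).$$ Then $\psi_1,\psi_2$ are unit vectors, the model generated by the probe $|\psi_1\rangle\otimes|\psi_2\rangle$ satisfies $A(\theta)=0$, and, if $F(\theta)>0$, it is fully compatible: $\mathcal I(\theta)=0$. 2. *(Orthonormal bases.)* For every number $d\ge1$ of parameters, every $\theta\in\mathbb R^d$ and every orthonormal basis $|\psi_1\rangle,\dots,|\psi_D\rangle$ of $\mathbb C^D$, the model generated by the probe $|\psi_1\rangle\otimes\cdots\otimes|\psi_D\rangle$ satisfies $A(\theta)=0$, and, if $F(\theta)>0$, also $\mathcal I(\theta)=0$. -/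

import Mathlib

open MeasureTheory Filter Topology Function
open scoped ComplexOrder

noncomputable section

namespace QEst

/-! ## Positive operator valued measures and their outcome distributions -/

/-- A POVM on the measurable outcome space `X`, acting on the Hilbert space `ℂ^n`:
a countably additive, positive, normalised, matrix-valued set function. Its values on
non-measurable sets are irrelevant. -/
structure POVM (n : Type*) [Fintype n] [DecidableEq n] (X : Type*) [MeasurableSpace X] where
  effect : Set X → Matrix n n ℂ
  posSemidef : ∀ s, MeasurableSet s → (effect s).PosSemidef
  effect_univ : effect Set.univ = 1
  hasSum_iUnion : ∀ f : ℕ → Set X, (∀ i, MeasurableSet (f i)) → Pairwise (Disjoint on f) →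
    HasSum (fun i => effect (f i)) (effect (⋃ i, f i))

section

variable {n : Type*} [Fintype n] [DecidableEq n] {X : Type*} [MeasurableSpace X]

theorem POVM.effect_empty (M : POVM n X) : M.effect ∅ = 0 := by
  have h := M.hasSum_iUnion (fun _ => ∅) (fun _ => MeasurableSet.empty)
    (fun _ _ _ => by simp)
  have h' := h.summable.tendsto_atTop_zero
  exact tendsto_nhds_unique tendsto_const_nhds h'

theorem exists_conjTranspose_mul_self {ρ : Matrix n n ℂ} (hρ : ρ.PosSemidef) :
    ∃ B : Matrix n n ℂ, ρ = B.conjTranspose * B := by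
  open scoped MatrixOrder Matrix.Norms.L2Operator in
  exact CStarAlgebra.nonneg_iff_eq_star_mul_self.1 hρ.nonneg

theorem trace_mul_re_nonneg {ρ E : Matrix n n ℂ} (hρ : ρ.PosSemidef) (hE : E.PosSemidef) :
    0 ≤ (Matrix.trace (ρ * E)).re := by
  obtain ⟨B, rfl⟩ := exists_conjTranspose_mul_self hρ
  have h := (hE.mul_mul_conjTranspose_same B).trace_nonneg
  rw [Matrix.mul_assoc, Matrix.trace_mul_comm]
  exact (Complex.le_def.1 h).1

/-- The outcome distribution `s ↦ Tr[ρ E(s)]` of the POVM `M` in the state `ρ`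
(defined to be `0` if `ρ` is not positive semidefinite). -/
def POVM.dist (M : POVM n X) (ρ : Matrix n n ℂ) : Measure X :=
  open Classical in
  if hρ : ρ.PosSemidef then
    Measure.ofMeasurable (fun s _ => ENNReal.ofReal (Matrix.trace (ρ * M.effect s)).re)
      (by simp [M.effect_empty])
      (by
        intro f hf hd
        have h1 := M.hasSum_iUnion f hf hd
        have hc : Continuous fun E : Matrix n n ℂ => (Matrix.trace (ρ * E)).re := by fun_prop
        let φ : Matrix n n ℂ →+ ℝ :=
          { toFun := fun E => (Matrix.trace (ρ * E)).re
            map_zero' := by simp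
            map_add' := by intro a b; simp [Matrix.mul_add] }
        have h2 : HasSum (fun i => (Matrix.trace (ρ * M.effect (f i))).re)
            (Matrix.trace (ρ * M.effect (⋃ i, f i))).re := h1.map φ hc
        rw [← h2.tsum_eq]
        exact ENNReal.ofReal_tsum_of_nonneg
          (fun i => trace_mul_re_nonneg hρ (M.posSemidef _ (hf i))) h2.summable)
  else 0

theorem POVM.dist_apply (M : POVM n X) {ρ : Matrix n n ℂ} (hρ : ρ.PosSemidef) {s : Set X}
    (hs : MeasurableSet s) :
    M.dist ρ s = ENNReal.ofReal (Matrix.trace (ρ * M.effect s)).re := by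
  rw [POVM.dist, dif_pos hρ, Measure.ofMeasurable_apply s hs]

end

/-! ## Tensor products -/

/-- The tensor product `⨂ₖ Aₖ` of a finite family of square matrices, acting on
`⨂ₖ ℂ^n = ℂ^(κ → n)`. -/
def tensor {κ n : Type*} [Fintype κ] (A : κ → Matrix n n ℂ) : Matrix (κ → n) (κ → n) ℂ :=
  Matrix.of fun a b => ∏ k, A k (a k) (b k)

/-- The product vector `⨂ₖ ψₖ`. -/
def tensorVec {κ n : Type*} [Fintype κ] (ψ : κ → EuclideanSpace ℂ n) : (κ → n) → ℂ :=
  fun a => ∏ k, ψ k (a k)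

/-! ## Parametric models, symmetric logarithmic derivatives, `F` and `A` -/

/-- The partial derivative `∂ᵢ f (θ)` of a matrix-valued function, taken entry by entry. -/
def pderiv {d : ℕ} {m n : Type*} (f : (Fin d → ℝ) → Matrix m n ℂ) (θ : Fin d → ℝ) (i : Fin d) :
    Matrix m n ℂ :=
  Matrix.of fun a b => deriv (fun t : ℝ => f (update θ i t) a b) (θ i)

section

variable {d : ℕ} {n : Type*} [Fintype n] [DecidableEq n]

/-- `L` is a symmetric logarithmic derivative of the model `ρ` at `θ` for the parameter `i`:
it is Hermitian and `∂ᵢρ = (ρ L + L ρ) / 2`. -/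
def IsSLD (ρ : (Fin d → ℝ) → Matrix n n ℂ) (θ : Fin d → ℝ) (i : Fin d)
    (L : Matrix n n ℂ) : Prop :=
  L.IsHermitian ∧ pderiv ρ θ i = (1 / 2 : ℂ) • (ρ θ * L + L * ρ θ)

open Classical in
/-- A symmetric logarithmic derivative `Lᵢ(θ)` (`0` if there is none). The matrices `qfi` and
`commMatrix` below do not depend on which solution is chosen. -/
def sld (ρ : (Fin d → ℝ) → Matrix n n ℂ) (θ : Fin d → ℝ) (i : Fin d) : Matrix n n ℂ :=
  if h : ∃ L, IsSLD ρ θ i L then h.choose else 0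

/-- The quantum Fisher information matrix `F_ij = ½ Tr[ρ (Lᵢ Lⱼ + Lⱼ Lᵢ)]` (a real number, as
`ρ`, `Lᵢ`, `Lⱼ` are Hermitian). -/
def qfi (ρ : (Fin d → ℝ) → Matrix n n ℂ) (θ : Fin d → ℝ) : Matrix (Fin d) (Fin d) ℝ :=
  Matrix.of fun i j =>
    (1 / 2) * (Matrix.trace (ρ θ * (sld ρ θ i * sld ρ θ j + sld ρ θ j * sld ρ θ i))).re

/-- The matrix `A_ij = (1 / 2i) Tr[ρ [Lᵢ, Lⱼ]]`. -/
def commMatrix (ρ : (Fin d → ℝ) → Matrix n n ℂ) (θ : Fin d → ℝ) : Matrix (Fin d) (Fin d) ℂ :=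
  Matrix.of fun i j =>
    (1 / (2 * Complex.I)) *
      Matrix.trace (ρ θ * (sld ρ θ i * sld ρ θ j - sld ρ θ j * sld ρ θ i))

/-! ## Locally unbiased measurements and the incompatibility measure -/

/-- The bias `bᵢ(θ) = 𝔼_θ[θ̂ᵢ] - θᵢ` of the estimator `θ̂ ∈ ℝ^d` read off from the POVM `M`. -/
def bias (ρ : (Fin d → ℝ) → Matrix n n ℂ) (M : POVM n (Fin d → ℝ)) (θ : Fin d → ℝ)
    (i : Fin d) : ℝ :=
  (∫ x, x i ∂(M.dist (ρ θ))) - θ i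

/-- The mean square error matrix `Σ_ij(θ) = 𝔼_θ[(θ̂ᵢ - θᵢ)(θ̂ⱼ - θⱼ)]`. -/
def mse (ρ : (Fin d → ℝ) → Matrix n n ℂ) (M : POVM n (Fin d → ℝ)) (θ : Fin d → ℝ) :
    Matrix (Fin d) (Fin d) ℝ :=
  Matrix.of fun i j => ∫ x, (x i - θ i) * (x j - θ j) ∂(M.dist (ρ θ))

/-- `M` is locally unbiased at `θ` (with bounded mean square error matrix): the estimator has a
mean at all parameter values near `θ`, it has finite second moments at `θ`, and both the bias and
all its first partial derivatives vanish at `θ`. -/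
structure IsLocallyUnbiased (ρ : (Fin d → ℝ) → Matrix n n ℂ) (θ : Fin d → ℝ)
    (M : POVM n (Fin d → ℝ)) : Prop where
  integrable_mean : ∀ᶠ θ' in 𝓝 θ, ∀ i, Integrable (fun x : Fin d → ℝ => x i) (M.dist (ρ θ'))
  bias_eq_zero : ∀ i, bias ρ M θ i = 0
  hasDerivAt_bias : ∀ i j, HasDerivAt (fun t : ℝ => bias ρ M (update θ j t) i) 0 (θ j)
  integrable_mse : ∀ i j,
    Integrable (fun x : Fin d → ℝ => (x i - θ i) * (x j - θ j)) (M.dist (ρ θ))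

/-- The model `ρ_θ^{⊗N}` of `N` independent copies. -/
def copies (N : ℕ) (ρ : (Fin d → ℝ) → Matrix n n ℂ) :
    (Fin d → ℝ) → Matrix (Fin N → n) (Fin N → n) ℂ :=
  fun θ => tensor fun _ : Fin N => ρ θ

/-- `r_N(θ) = inf_M sup_G  N Tr[G Σ⁽ᴺ⁾(θ)] / Tr[G F⁻¹(θ)]`, where `M` runs over the locally
unbiased POVMs on `N` copies and `G` over the nonzero real positive semidefinite weight matrices
(for `G = 0` the ratio is `0 / 0`). The value is an extended real. -/
def rN (N : ℕ) (ρ : (Fin d → ℝ) → Matrix n n ℂ) (θ : Fin d → ℝ) : EReal :=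
  ⨅ M ∈ {M : POVM (Fin N → n) (Fin d → ℝ) | IsLocallyUnbiased (copies N ρ) θ M},
    ⨆ G ∈ {G : Matrix (Fin d) (Fin d) ℝ | G.PosSemidef ∧ G ≠ 0},
      (((N : ℝ) * (G * mse (copies N ρ) M θ).trace / (G * (qfi ρ θ)⁻¹).trace : ℝ) : EReal)

/-- The incompatibility measure `𝓘(θ) = liminf_{N → ∞} r_N(θ) - 1`. -/
def incompatibility (ρ : (Fin d → ℝ) → Matrix n n ℂ) (θ : Fin d → ℝ) : EReal :=
  liminf (fun N : ℕ => rN N ρ θ) atTop - 1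

end

/-! ## Unitary encodings -/

section

variable {d D : ℕ}

/-- The encoding `U_θ = exp(i ∑ⱼ θⱼ Hⱼ)`. -/
def encodingU (H : Fin d → Matrix (Fin D) (Fin D) ℂ) (θ : Fin d → ℝ) :
    Matrix (Fin D) (Fin D) ℂ :=
  NormedSpace.exp (Complex.I • ∑ j, (θ j : ℂ) • H j)

/-- The effective generators `Hⱼ^eff(θ)`, i.e. the first order coefficients in
`U_{-θ} U_{θ + δθ} = 1 + i ∑ⱼ δθⱼ Hⱼ^eff(θ) + o(δθ)`. -/
def heff (H : Fin d → Matrix (Fin D) (Fin D) ℂ) (θ : Fin d → ℝ) (j : Fin d) :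
    Matrix (Fin D) (Fin D) ℂ :=
  -Complex.I • pderiv (fun θ' => encodingU H (-θ) * encodingU H θ') θ j

/-- The model generated from the product probe `⨂ₖ |ψₖ⟩`, each factor of which goes through the
encoding: `ρ_θ = U_θ^{⊗κ} |Ψ⟩⟨Ψ| (U_θ^{⊗κ})†` with `Ψ = ⨂ₖ ψₖ`. -/
def productModel {κ : Type*} [Fintype κ] [DecidableEq κ] (H : Fin d → Matrix (Fin D) (Fin D) ℂ)
    (ψ : κ → EuclideanSpace ℂ (Fin D)) :
    (Fin d → ℝ) → Matrix (κ → Fin D) (κ → Fin D) ℂ :=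
  fun θ => tensor (fun _ : κ => encodingU H θ) *
    Matrix.vecMulVec (tensorVec ψ) (star (tensorVec ψ)) *
      (tensor (fun _ : κ => encodingU H θ)).conjTranspose

/-- The two factors of the generalized anti-parallel probe,
`(|S| + ‖ν‖²)^{-1/2} (∑_{j ∈ S} e^{i φ j} v j (s j) + ν)`. -/
def antiparallelState {m : ℕ} (v : Fin m → Fin 2 → EuclideanSpace ℂ (Fin D)) (S : Finset (Fin m))
    (s : Fin m → Fin 2) (φ : Fin m → ℝ) (ν : EuclideanSpace ℂ (Fin D)) :
    EuclideanSpace ℂ (Fin D) :=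
  ((Real.sqrt (S.card + ‖ν‖ ^ 2) : ℂ))⁻¹ •
    (∑ j ∈ S, Complex.exp (Complex.I * φ j) • v j (s j) + ν)

end

end QEst

end

set_option linter.unusedSectionVars false

noncomputable section

namespace QEst

/-! ## Algebra of tensor products -/

section TensorAlgebra

variable {κ n : Type*} [Fintype κ]

/-! For a pure model `ρ θ = |Ψ⟩⟨Ψ|` everything is governed by the tangent vectors `l_j = L_j Ψ`:
they are orthogonal to `Ψ`, and `⟨l_i, l_j⟩ = Tr[ρ L_i L_j]` has real part `F_ij` and imaginary part
`A_ij`. If `A = 0`, the Gram matrix of the `l_j` is the real matrix `F`, so a real change of basis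
makes them orthonormal vectors `e_a`. Measuring along `Ψ/√d ± e_a`, with suitable outcomes, is then
locally unbiased with error matrix exactly `F⁻¹` (`exists_isLocallyUnbiased_mse_eq`).

The `N`-copy model is again pure, with `∑ₖ site k L_j` as logarithmic derivatives, and its Gram
matrix is `N F`, because cross terms between different copies contain `Tr[ρ L_i] = 0`. So some
locally unbiased measurement has error `(N F)⁻¹`, while the quantum Cramér–Rao inequality
(`IsLocallyUnbiased.cramerRao`) forbids anything better. Hence `r_N = 1` for every `N ≥ 1`
(`IsPureModel.rN_eq_one`), and the incompatibility vanishes as soon as `A = 0`.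

It remains to compute `A` for a product probe. Rotating back by the encoding, `A_ij = -2i ∑ₖ ⟨ψₖ,
[H_i^eff, H_j^eff] ψₖ⟩` (`commMatrix_productModel`), since generators on different factors commute.
For an orthonormal basis the sum is the trace of a commutator. For the anti-parallel pair the two
expectations of `C` are opposite: the eigenvalues `±i a_j` are exchanged between the factors, the
kernel parts contribute nothing, and equal norms of `ν₁, ν₂` give equal normalisations. -/

theorem tensor_mul [DecidableEq κ] [Fintype n] (A B : κ → Matrix n n ℂ) :
    tensor A * tensor B = tensor fun k => A k * B k := by
  ext a b
  simp only [tensor, Matrix.mul_apply, Matrix.of_apply, ← Finset.prod_mul_distrib]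
  rw [Finset.prod_univ_sum, Fintype.piFinset_univ]

theorem trace_tensor [DecidableEq κ] [Fintype n] (A : κ → Matrix n n ℂ) :
    (tensor A).trace = ∏ k, (A k).trace := by
  simp only [tensor, Matrix.trace, Matrix.diag, Matrix.of_apply]
  rw [Finset.prod_univ_sum, Fintype.piFinset_univ]

theorem conjTranspose_tensor (A : κ → Matrix n n ℂ) :
    (tensor A).conjTranspose = tensor fun k => (A k).conjTranspose := by
  ext a b
  simp [tensor, Matrix.conjTranspose_apply]

theorem tensor_one [DecidableEq n] [DecidableEq κ] :
    tensor (fun _ : κ => (1 : Matrix n n ℂ)) = 1 := by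
  ext a b
  simp only [tensor, Matrix.of_apply, Matrix.one_apply]
  by_cases h : a = b
  · simp [h]
  · obtain ⟨k, hk⟩ := Function.ne_iff.1 h
    rw [if_neg h]
    exact Finset.prod_eq_zero (Finset.mem_univ k) (if_neg hk)

theorem tensor_vecMulVec (x : κ → n → ℂ) :
    tensor (fun k => Matrix.vecMulVec (x k) (star (x k))) =
      Matrix.vecMulVec (fun a => ∏ k, x k (a k)) (star fun a => ∏ k, x k (a k)) := by
  ext a b
  simp [tensor, Matrix.vecMulVec_apply, Finset.prod_mul_distrib]

variable [DecidableEq κ]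

/-- Isolating one factor reduces multilinearity and the Leibniz rule for `tensor` to scalar
identities. -/
theorem tensor_update_apply (A : κ → Matrix n n ℂ) (k : κ) (X : Matrix n n ℂ) (a b : κ → n) :
    tensor (update A k X) a b =
      X (a k) (b k) * ∏ l ∈ Finset.univ.erase k, A l (a l) (b l) := by
  simp only [tensor, Matrix.of_apply]
  rw [← Finset.mul_prod_erase _ _ (Finset.mem_univ k), update_self]
  congr 1
  exact Finset.prod_congr rfl fun l hl => by rw [update_of_ne (Finset.ne_of_mem_erase hl)]

theorem tensor_update_add (A : κ → Matrix n n ℂ) (k : κ) (X Y : Matrix n n ℂ) :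
    tensor (update A k (X + Y)) = tensor (update A k X) + tensor (update A k Y) := by
  ext a b
  simp [tensor_update_apply, add_mul]

theorem tensor_update_sub (A : κ → Matrix n n ℂ) (k : κ) (X Y : Matrix n n ℂ) :
    tensor (update A k (X - Y)) = tensor (update A k X) - tensor (update A k Y) := by
  ext a b
  simp [tensor_update_apply, sub_mul]

theorem tensor_update_smul (A : κ → Matrix n n ℂ) (k : κ) (c : ℂ) (X : Matrix n n ℂ) :
    tensor (update A k (c • X)) = c • tensor (update A k X) := by
  ext a b
  simp [tensor_update_apply, mul_assoc]

variable [Fintype n] [DecidableEq n]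

/-- The operator acting as `A` on the tensor factor `k` and as the identity on the others. -/
def site (k : κ) (A : Matrix n n ℂ) : Matrix (κ → n) (κ → n) ℂ :=
  tensor (update (fun _ => 1) k A)

theorem tensor_mul_site (A : κ → Matrix n n ℂ) (k : κ) (X : Matrix n n ℂ) :
    tensor A * site k X = tensor (update A k (A k * X)) := by
  rw [site, tensor_mul]
  congr 1
  ext1 l
  by_cases h : l = k
  · subst h; simp
  · simp [h]

theorem site_mul_tensor (A : κ → Matrix n n ℂ) (k : κ) (X : Matrix n n ℂ) :
    site k X * tensor A = tensor (update A k (X * A k)) := by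
  rw [site, tensor_mul]
  congr 1
  ext1 l
  by_cases h : l = k
  · subst h; simp
  · simp [h]

theorem site_mul_site (k : κ) (X Y : Matrix n n ℂ) : site k X * site k Y = site k (X * Y) := by
  rw [site, tensor_mul_site, update_self, update_idem, site]

theorem site_mul_site_comm {k l : κ} (h : k ≠ l) (X Y : Matrix n n ℂ) :
    site k X * site l Y = site l Y * site k X := by
  rw [site, tensor_mul_site, site_mul_tensor, update_of_ne h.symm, one_mul, mul_one]

theorem conjTranspose_site (k : κ) (X : Matrix n n ℂ) :
    (site k X).conjTranspose = site k X.conjTranspose := by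
  rw [site, conjTranspose_tensor, site]
  congr 1
  ext1 l
  by_cases h : l = k
  · subst h; simp
  · simp [h]

theorem trace_tensor_update (A : κ → Matrix n n ℂ) (k : κ) (X : Matrix n n ℂ)
    (hA : ∀ l, (A l).trace = 1) : (tensor (update A k X)).trace = X.trace := by
  rw [trace_tensor, ← Finset.mul_prod_erase _ _ (Finset.mem_univ k), update_self,
    Finset.prod_eq_one, mul_one]
  intro l hl
  rw [update_of_ne (Finset.ne_of_mem_erase hl), hA]

theorem trace_tensor_update_update (A : κ → Matrix n n ℂ) {k l : κ} (h : k ≠ l)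
    (X Y : Matrix n n ℂ) (hX : X.trace = 0) :
    (tensor (update (update A k X) l Y)).trace = 0 := by
  rw [trace_tensor]
  exact Finset.prod_eq_zero (Finset.mem_univ k) (by rw [update_of_ne h, update_self, hX])

/-- Operators on different factors commute, so only the diagonal terms of the double sum survive. -/
theorem commutator_sum_site (X Y : Matrix n n ℂ) :
    (∑ k : κ, site k X) * (∑ k : κ, site k Y) - (∑ k : κ, site k Y) * (∑ k : κ, site k X) =
      ∑ k : κ, site k (X * Y - Y * X) := by
  rw [Finset.sum_mul_sum, Finset.sum_mul_sum]
  rw [Finset.sum_comm (f := fun i j => site i Y * site j X), ← Finset.sum_sub_distrib]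
  refine Finset.sum_congr rfl fun k _ => ?_
  rw [← Finset.sum_sub_distrib, Finset.sum_eq_single k]
  · rw [site_mul_site, site_mul_site, site, site, site, tensor_update_sub]
  · intro l _ hl
    rw [site_mul_site_comm hl.symm, sub_self]
  · simp

/-- Additivity of Fisher information over copies: a term with two distinct sites contains the factor
`Tr[ρ X] = 0`, and each of the remaining terms is a one-copy trace. -/
theorem trace_tensor_mul_sum_site_mul_sum_site (ρ X Y : Matrix n n ℂ) (hρ : ρ.trace = 1)
    (hX : (ρ * X).trace = 0) :
    (tensor (fun _ : κ => ρ) * ((∑ k : κ, site k X) * ∑ k : κ, site k Y)).trace =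
      Fintype.card κ * (ρ * (X * Y)).trace := by
  rw [Finset.sum_mul_sum, Finset.mul_sum, Matrix.trace_sum]
  simp_rw [Finset.mul_sum, Matrix.trace_sum]
  have h (k : κ) : ∑ l, (tensor (fun _ : κ => ρ) * (site k X * site l Y)).trace =
      (ρ * (X * Y)).trace := by
    rw [Finset.sum_eq_single k]
    · rw [site_mul_site, tensor_mul_site, trace_tensor_update _ _ _ fun _ => hρ]
    · intro l _ hl
      rw [← Matrix.mul_assoc, tensor_mul_site, tensor_mul_site]
      exact trace_tensor_update_update _ hl.symm _ _ hX
    · simp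
  simp [h]

end TensorAlgebra

/-! ## Entrywise derivatives of matrix-valued functions -/

/-- The matrix-valued function `f` has the entrywise derivative `f'` at `t`. -/
def HasEntryDerivAt {m n : Type*} (f : ℝ → Matrix m n ℂ) (f' : Matrix m n ℂ) (t : ℝ) : Prop :=
  ∀ a b, HasDerivAt (fun s => f s a b) (f' a b) t

namespace HasEntryDerivAt

variable {l m n : Type*} {t : ℝ}

theorem const (A : Matrix m n ℂ) : HasEntryDerivAt (fun _ => A) 0 t :=
  fun a b => hasDerivAt_const t (A a b)

theorem unique {f : ℝ → Matrix m n ℂ} {f' g' : Matrix m n ℂ} (hf : HasEntryDerivAt f f' t)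
    (hg : HasEntryDerivAt f g' t) : f' = g' := by
  ext a b
  exact (hf a b).unique (hg a b)

theorem mul [Fintype m] {f : ℝ → Matrix l m ℂ} {g : ℝ → Matrix m n ℂ} {f' : Matrix l m ℂ}
    {g' : Matrix m n ℂ} (hf : HasEntryDerivAt f f' t) (hg : HasEntryDerivAt g g' t) :
    HasEntryDerivAt (fun s => f s * g s) (f' * g t + f t * g') t := by
  intro a b
  simp only [Matrix.mul_apply, Matrix.add_apply, ← Finset.sum_add_distrib]
  exact HasDerivAt.fun_sum fun c _ => (hf a c).mul (hg c b)

theorem conjTranspose {f : ℝ → Matrix m n ℂ} {f' : Matrix m n ℂ} (hf : HasEntryDerivAt f f' t) :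
    HasEntryDerivAt (fun s => (f s).conjTranspose) f'.conjTranspose t :=
  fun a b => (hf b a).star

theorem trace [Fintype n] {f : ℝ → Matrix n n ℂ} {f' : Matrix n n ℂ}
    (hf : HasEntryDerivAt f f' t) : HasDerivAt (fun s => (f s).trace) f'.trace t := by
  simp only [Matrix.trace, Matrix.diag]
  exact HasDerivAt.fun_sum fun c _ => hf c c

theorem tensor {κ : Type*} [Fintype κ] [DecidableEq κ] {f : ℝ → Matrix n n ℂ}
    {f' : Matrix n n ℂ} (hf : HasEntryDerivAt f f' t) :
    HasEntryDerivAt (fun s => tensor fun _ : κ => f s)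
      (∑ k, QEst.tensor (update (fun _ : κ => f t) k f')) t := by
  intro a b
  have h := HasDerivAt.fun_finsetProd (u := (Finset.univ : Finset κ))
    (f := fun k s => f s (a k) (b k)) (f' := fun k => f' (a k) (b k)) (x := t)
    (fun k _ => hf (a k) (b k))
  refine h.congr_deriv ?_
  rw [Matrix.sum_apply]
  refine Finset.sum_congr rfl fun k _ => ?_
  rw [tensor_update_apply, smul_eq_mul, mul_comm]

end HasEntryDerivAt

theorem HasEntryDerivAt.pderiv_eq {d : ℕ} {m n : Type*} {f : (Fin d → ℝ) → Matrix m n ℂ}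
    {θ : Fin d → ℝ} {i : Fin d} {f' : Matrix m n ℂ}
    (hf : HasEntryDerivAt (fun t => f (update θ i t)) f' (θ i)) : pderiv f θ i = f' := by
  ext a b
  exact (hf a b).deriv

/-! ## The quantum Cramér–Rao inequality -/

section CramerRao

/-- Interchanges a limit of functionals with a derivative, without any uniformity. The vectors on
which `φ R` converges form a subspace, closed because `E` is finite-dimensional. It contains `f s`
for `s` near `t`, hence also `f'`, and the limit functional on it is linear and continuous. This
replaces the operator `∫ y dM`, which need not exist for an unbounded estimator. -/
theorem tendsto_of_hasDerivAt_of_tendsto {E : Type*} [NormedAddCommGroup E] [NormedSpace ℝ E]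
    [FiniteDimensional ℝ E] (φ : ℕ → E →ₗ[ℝ] ℝ) {f : ℝ → E} {f' : E} {g : ℝ → ℝ} {g' t : ℝ}
    (hf : HasDerivAt f f' t) (hg : HasDerivAt g g' t)
    (h : ∀ᶠ s in 𝓝 t, Tendsto (fun R => φ R (f s)) atTop (𝓝 (g s))) :
    Tendsto (fun R => φ R f') atTop (𝓝 g') := by
  let T : Submodule ℝ E :=
    { carrier := {x | ∃ c, Tendsto (fun R => φ R x) atTop (𝓝 c)}
      zero_mem' := ⟨0, by simp⟩
      add_mem' := by
        rintro x y ⟨c, hc⟩ ⟨c', hc'⟩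
        exact ⟨c + c', by simpa using hc.add hc'⟩
      smul_mem' := by
        rintro r x ⟨c, hc⟩
        exact ⟨r * c, by simpa using hc.const_mul r⟩ }
  choose! ℓ hℓ using fun (x : E) (hx : x ∈ T) => hx
  let ℓT : T →ₗ[ℝ] ℝ :=
    { toFun := fun x => ℓ x
      map_add' := fun x y => tendsto_nhds_unique (hℓ _ (x + y).2)
        (by simpa using (hℓ _ x.2).add (hℓ _ y.2))
      map_smul' := fun r x => tendsto_nhds_unique (hℓ _ (r • x).2)
        (by simpa using (hℓ _ x.2).const_mul r) }
  -- An extension to all of `E` lets the chain rule apply to `L ∘ f`; the values off `T` play no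
  -- role.
  obtain ⟨L, hL⟩ := LinearMap.exists_extend ℓT
  have hL' (x : E) (hx : x ∈ T) : L x = ℓ x := LinearMap.congr_fun hL ⟨x, hx⟩
  have hmem : ∀ᶠ s in 𝓝 t, f s ∈ T := h.mono fun s hs => ⟨_, hs⟩
  have hf'T : f' ∈ T := by
    have hs := hasDerivAt_iff_tendsto_slope.1 hf
    refine T.closed_of_finiteDimensional.mem_of_tendsto hs ?_
    filter_upwards [hmem.filter_mono nhdsWithin_le_nhds] with s hs
    rw [slope_def_module]
    exact T.smul_mem _ (T.sub_mem hs hmem.self_of_nhds)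
  have h1 : HasDerivAt (fun s => L (f s)) (L f') t :=
    (LinearMap.toContinuousLinearMap L).hasFDerivAt.comp_hasDerivAt t hf
  have h2 : (fun s => L (f s)) =ᶠ[𝓝 t] g := by
    filter_upwards [h] with s hs
    rw [hL' _ ⟨_, hs⟩]
    exact tendsto_nhds_unique (hℓ _ ⟨_, hs⟩) hs
  have h3 : ℓ f' = g' := by
    rw [← hL' _ hf'T]
    exact (h1.congr_of_eventuallyEq h2.symm).unique hg
  exact h3 ▸ hℓ _ hf'T

variable {n : Type*} [Fintype n] [DecidableEq n] {X : Type*} [MeasurableSpace X]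

instance (M : POVM n X) (ρ : Matrix n n ℂ) : IsFiniteMeasure (M.dist ρ) := by
  by_cases h : ρ.PosSemidef
  · exact ⟨by rw [M.dist_apply h MeasurableSet.univ]; exact ENNReal.ofReal_lt_top⟩
  · rw [POVM.dist, dif_neg h]
    infer_instance

theorem POVM.real_dist_apply (M : POVM n X) {ρ : Matrix n n ℂ} (hρ : ρ.PosSemidef) {s : Set X}
    (hs : MeasurableSet s) : (M.dist ρ).real s = (ρ * M.effect s).trace.re := by
  rw [measureReal_def, M.dist_apply hρ hs,
    ENNReal.toReal_ofReal (trace_mul_re_nonneg hρ (M.posSemidef s hs))]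

/-- The operator `∫ f dM` for a simple function `f`. -/
def POVM.simpleIntegral (M : POVM n X) (f : SimpleFunc X ℝ) : Matrix n n ℂ :=
  ∑ c ∈ f.range, (c : ℂ) • M.effect (f ⁻¹' {c})

theorem POVM.trace_mul_simpleIntegral (M : POVM n X) (A : Matrix n n ℂ) (f : SimpleFunc X ℝ) :
    (A * M.simpleIntegral f).trace.re =
      ∑ c ∈ f.range, c * (A * M.effect (f ⁻¹' {c})).trace.re := by
  simp [POVM.simpleIntegral, Finset.mul_sum, Matrix.trace_sum]

theorem POVM.integral_simpleFunc (M : POVM n X) {ρ : Matrix n n ℂ} (hρ : ρ.PosSemidef)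
    (f : SimpleFunc X ℝ) : ∫ x, f x ∂(M.dist ρ) = (ρ * M.simpleIntegral f).trace.re := by
  rw [SimpleFunc.integral_eq_sum _ (f.integrable_of_isFiniteMeasure),
    POVM.trace_mul_simpleIntegral]
  refine Finset.sum_congr rfl fun c _ => ?_
  rw [M.real_dist_apply hρ (f.measurableSet_preimage _), smul_eq_mul, mul_comm]

theorem POVM.integral_sq_simpleFunc (M : POVM n X) {ρ : Matrix n n ℂ} (hρ : ρ.PosSemidef)
    (f : SimpleFunc X ℝ) :
    ∫ x, f x ^ 2 ∂(M.dist ρ) =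
      ∑ c ∈ f.range, c ^ 2 * (ρ * M.effect (f ⁻¹' {c})).trace.re := by
  have h := SimpleFunc.map_integral (μ := M.dist ρ) f (fun c => c ^ 2)
    (f.integrable_of_isFiniteMeasure) (by simp)
  rw [SimpleFunc.integral_eq_integral _ (SimpleFunc.integrable_of_isFiniteMeasure _)] at h
  simp only [SimpleFunc.map_apply] at h
  rw [h]
  refine Finset.sum_congr rfl fun c _ => ?_
  rw [M.real_dist_apply hρ (f.measurableSet_preimage _), smul_eq_mul, mul_comm]

/-- No normalisation is assumed, since this is applied to `L * ρ * L`. -/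
theorem POVM.sum_trace_effect_fiber (M : POVM n X) {ρ : Matrix n n ℂ} (hρ : ρ.PosSemidef)
    (f : SimpleFunc X ℝ) :
    ∑ c ∈ f.range, (ρ * M.effect (f ⁻¹' {c})).trace.re = ρ.trace.re := by
  have h := sum_measureReal_preimage_singleton (μ := M.dist ρ) f.range (f := f)
    fun y _ => f.measurableSet_preimage _
  rw [SimpleFunc.coe_range, Set.preimage_range, M.real_dist_apply hρ MeasurableSet.univ,
    M.effect_univ, mul_one] at h
  rw [← h]
  exact Finset.sum_congr rfl fun c _ => (M.real_dist_apply hρ (f.measurableSet_preimage _)).symm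

/-- Sum `Tr[(c - L) ρ (c - L) E_c] ≥ 0` over the values `c` of `f`, where `E_c` is the effect of the
fibre over `c`. -/
theorem POVM.integral_sq_simpleFunc_ge (M : POVM n X) {ρ L : Matrix n n ℂ} (hρ : ρ.PosSemidef)
    (hL : L.IsHermitian) (f : SimpleFunc X ℝ) :
    ((ρ * L + L * ρ) * M.simpleIntegral f).trace.re - (ρ * (L * L)).trace.re ≤
      ∫ x, f x ^ 2 ∂(M.dist ρ) := by
  have hLρ : (L * ρ * L).PosSemidef := by
    simpa [hL.eq] using hρ.mul_mul_conjTranspose_same L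
  have htr : (L * ρ * L).trace = (ρ * (L * L)).trace := by
    rw [Matrix.mul_assoc, Matrix.trace_mul_comm, Matrix.mul_assoc]
  rw [M.integral_sq_simpleFunc hρ, ← htr, ← M.sum_trace_effect_fiber hLρ f,
    M.trace_mul_simpleIntegral, ← Finset.sum_sub_distrib]
  refine Finset.sum_le_sum fun c _ => ?_
  have hE := M.posSemidef _ (f.measurableSet_preimage {c})
  set E := M.effect (f ⁻¹' {c})
  have hH : ((c : ℂ) • (1 : Matrix n n ℂ) - L).conjTranspose = (c : ℂ) • 1 - L := by
    simp [Matrix.conjTranspose_sub, Matrix.conjTranspose_smul, hL.eq]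
  have h0 := trace_mul_re_nonneg (hρ.mul_mul_conjTranspose_same ((c : ℂ) • 1 - L)) hE
  have h1 : ((c : ℂ) • 1 - L) * ρ * ((c : ℂ) • 1 - L) * E =
      ((c ^ 2 : ℝ) : ℂ) • (ρ * E) - (c : ℂ) • ((ρ * L + L * ρ) * E) + L * ρ * L * E := by
    simp only [sub_mul, mul_sub, smul_mul_assoc, mul_smul_comm, one_mul, mul_one, smul_sub,
      add_mul, smul_add, smul_smul]
    push_cast
    rw [sq]
    abel
  rw [hH, h1, Matrix.trace_add, Matrix.trace_sub, Matrix.trace_smul, Matrix.trace_smul,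
    Complex.add_re, Complex.sub_re, smul_eq_mul, smul_eq_mul, Complex.re_ofReal_mul,
    Complex.re_ofReal_mul] at h0
  linarith

theorem tendsto_integral_sq_approxOn {μ : Measure X} [IsFiniteMeasure μ] {y : X → ℝ}
    (hy : Measurable y) (hy2 : Integrable (fun x => y x ^ 2) μ) :
    Tendsto (fun R => ∫ x, SimpleFunc.approxOn y hy Set.univ 0 (Set.mem_univ _) R x ^ 2 ∂μ)
      atTop (𝓝 (∫ x, y x ^ 2 ∂μ)) := by
  -- The approximants satisfy `|y_R| ≤ 2 |y|`, whence the factor `4`.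
  refine tendsto_integral_of_dominated_convergence (fun x => 4 * y x ^ 2) ?_
    (hy2.const_mul 4) ?_ ?_
  · intro R
    exact ((SimpleFunc.measurable _).pow_const 2).aestronglyMeasurable
  · intro R
    refine Eventually.of_forall fun x => ?_
    have h := SimpleFunc.norm_approxOn_zero_le hy (Set.mem_univ 0) x R
    rw [norm_pow]
    calc _ ≤ (‖y x‖ + ‖y x‖) ^ 2 := by gcongr
      _ = 4 * y x ^ 2 := by rw [← two_mul, mul_pow, Real.norm_eq_abs, sq_abs]; norm_num
  · refine Eventually.of_forall fun x => ?_
    exact (SimpleFunc.tendsto_approxOn hy (Set.mem_univ 0) (by simp)).pow 2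

variable {d : ℕ}

/-- Apply the simple-function inequality to approximations of `y = u · (x - θ)` with `L = ∑ w_j
L_j`, and pass to the limit; local unbiasedness turns the cross term into `2 u · w`. Leaving `w`
free avoids inverting the Fisher matrix: for invertible `F`, the choice `w = F⁻¹ u` gives the usual
bound. -/
theorem IsLocallyUnbiased.cramerRao {ρ : (Fin d → ℝ) → Matrix n n ℂ} {θ : Fin d → ℝ}
    {M : POVM n (Fin d → ℝ)} (hM : IsLocallyUnbiased ρ θ M) (hρ : ∀ θ', (ρ θ').PosSemidef)
    (htr : ∀ θ', (ρ θ').trace = 1)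
    {L : Fin d → Matrix n n ℂ} (hL : ∀ j, (L j).IsHermitian)
    (hd : ∀ j, HasEntryDerivAt (fun t => ρ (update θ j t))
      ((1 / 2 : ℂ) • (ρ θ * L j + L j * ρ θ)) (θ j)) (u w : Fin d → ℝ) :
    2 * (u ⬝ᵥ w) - ∑ i, ∑ j, w i * w j * (ρ θ * (L i * L j)).trace.re ≤
      ∑ i, ∑ j, u i * u j * mse ρ M θ i j := by
  let y : (Fin d → ℝ) → ℝ := fun x => ∑ i, u i * (x i - θ i)
  have hy : Measurable y := by fun_prop
  let yR : ℕ → SimpleFunc (Fin d → ℝ) ℝ :=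
    SimpleFunc.approxOn y hy Set.univ 0 (Set.mem_univ _)
  have hsq (x : Fin d → ℝ) :
      y x ^ 2 = ∑ i, ∑ j, u i * u j * ((x i - θ i) * (x j - θ j)) := by
    simp only [y, sq, Finset.sum_mul_sum]
    exact Finset.sum_congr rfl fun i _ => Finset.sum_congr rfl fun j _ => by ring
  have hint (i j : Fin d) :
      Integrable (fun x => u i * u j * ((x i - θ i) * (x j - θ j))) (M.dist (ρ θ)) :=
    (hM.integrable_mse i j).const_mul _
  have hy2 : Integrable (fun x => y x ^ 2) (M.dist (ρ θ)) := by
    simp only [hsq]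
    exact integrable_finsetSum _ fun i _ => integrable_finsetSum _ fun j _ => hint i j
  have hV : ∫ x, y x ^ 2 ∂(M.dist (ρ θ)) = ∑ i, ∑ j, u i * u j * mse ρ M θ i j := by
    simp only [hsq]
    rw [integral_finsetSum _ fun i _ => integrable_finsetSum _ fun j _ => hint i j]
    refine Finset.sum_congr rfl fun i _ => ?_
    rw [integral_finsetSum _ fun j _ => hint i j]
    exact Finset.sum_congr rfl fun j _ => integral_const_mul _ _
  -- The function type `n → n → ℂ` carries the sup norm, for which entrywise differentiability is
  -- differentiability.
  let φ : ℕ → (n → n → ℂ) →ₗ[ℝ] ℝ := fun R =>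
    { toFun := fun A => (Matrix.of A * M.simpleIntegral (yR R)).trace.re
      map_add' := fun A B => by
        have : Matrix.of (A + B) = Matrix.of A + Matrix.of B := rfl
        rw [this, Matrix.add_mul, Matrix.trace_add, Complex.add_re]
      map_smul' := fun r A => by
        have : Matrix.of (r • A) = (r : ℂ) • Matrix.of A := by ext a b; simp
        rw [this, Matrix.smul_mul, Matrix.trace_smul, smul_eq_mul, Complex.re_ofReal_mul]
        rfl }
  have hφ (R : ℕ) (A : Matrix n n ℂ) : φ R A = (A * M.simpleIntegral (yR R)).trace.re := rfl
  have key (j : Fin d) : Tendsto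
      (fun R => φ R ((1 / 2 : ℂ) • (ρ θ * L j + L j * ρ θ))) atTop (𝓝 (u j)) := by
    refine tendsto_of_hasDerivAt_of_tendsto φ (f := fun t => ρ (update θ j t)) (t := θ j)
      -- This is the mean of `y` at the shifted parameter. The bias has zero derivative, so the
      -- derivative is `u j`.
      (g := fun t => ∑ i, u i * (bias ρ M (update θ j t) i + (update θ j t i - θ i)))
      (hasDerivAt_pi.2 fun a => hasDerivAt_pi.2 fun b => hd j a b) ?_ ?_
    · have h1 (i : Fin d) : HasDerivAt (fun t => update θ j t i - θ i)
          ((Pi.single j 1 : Fin d → ℝ) i) (θ j) :=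
        (hasDerivAt_pi.1 (hasDerivAt_update θ j (θ j)) i).sub_const _
      have h2 := HasDerivAt.fun_sum (u := (Finset.univ : Finset (Fin d))) fun i _ =>
        ((hM.hasDerivAt_bias i j).add (h1 i)).const_mul (u i)
      refine h2.congr_deriv ?_
      simp [Pi.single_apply]
    · have hu : Tendsto (fun t => update θ j t) (𝓝 (θ j)) (𝓝 θ) := by
        have : Continuous fun t => update θ j t := by fun_prop
        simpa using this.tendsto (θ j)
      filter_upwards [hu.eventually hM.integrable_mean] with t ht
      have hxi (i : Fin d) :
          Integrable (fun x => u i * (x i - θ i)) (M.dist (ρ (update θ j t))) :=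
        ((ht i).sub (integrable_const _)).const_mul _
      have hyi : Integrable y (M.dist (ρ (update θ j t))) :=
        integrable_finsetSum _ fun i _ => hxi i
      have hlim := tendsto_integral_approxOn_of_measurable (s := Set.univ) hyi hy (by simp)
        (Set.mem_univ 0) (integrable_const _)
      have hmass : (M.dist (ρ (update θ j t))).real Set.univ = 1 := by
        rw [M.real_dist_apply (hρ _) MeasurableSet.univ, M.effect_univ, mul_one, htr,
          Complex.one_re]
      have hval : ∫ x, y x ∂(M.dist (ρ (update θ j t))) =
          ∑ i, u i * (bias ρ M (update θ j t) i + (update θ j t i - θ i)) := by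
        simp only [y]
        rw [integral_finsetSum _ fun i _ => hxi i]
        refine Finset.sum_congr rfl fun i _ => ?_
        rw [integral_const_mul, integral_sub (ht i) (integrable_const _), integral_const,
          hmass, bias, one_smul]
        ring
      rw [← hval]
      refine hlim.congr fun R => ?_
      rw [SimpleFunc.integral_eq_integral _ (SimpleFunc.integrable_of_isFiniteMeasure _)]
      exact M.integral_simpleFunc (hρ _) (yR R)
  have hLH : (∑ j, (w j : ℂ) • L j).IsHermitian := by
    simp [Matrix.IsHermitian, Matrix.conjTranspose_sum, Matrix.conjTranspose_smul, (hL _).eq]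
  have hcross (R : ℕ) : ((ρ θ * (∑ j, (w j : ℂ) • L j) + (∑ j, (w j : ℂ) • L j) * ρ θ) *
      M.simpleIntegral (yR R)).trace.re =
      2 * ∑ j, w j * φ R ((1 / 2 : ℂ) • (ρ θ * L j + L j * ρ θ)) := by
    have h2 (j : Fin d) : (w j : ℂ) • (ρ θ * L j + L j * ρ θ) =
        ((2 * w j : ℝ) : ℂ) • ((1 / 2 : ℂ) • (ρ θ * L j + L j * ρ θ)) := by
      rw [smul_smul]; congr 1; push_cast; ring
    rw [Finset.mul_sum, Finset.sum_mul, ← Finset.sum_add_distrib, Finset.sum_mul,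
      Matrix.trace_sum, Complex.re_sum, Finset.mul_sum]
    refine Finset.sum_congr rfl fun j _ => ?_
    rw [mul_smul_comm, smul_mul_assoc, ← smul_add, h2, Matrix.smul_mul, Matrix.trace_smul,
      smul_eq_mul, Complex.re_ofReal_mul, hφ, mul_assoc]
  have hquad : (ρ θ * ((∑ j, (w j : ℂ) • L j) * ∑ j, (w j : ℂ) • L j)).trace.re =
      ∑ i, ∑ j, w i * w j * (ρ θ * (L i * L j)).trace.re := by
    rw [Finset.sum_mul_sum, Finset.mul_sum, Matrix.trace_sum, Complex.re_sum]
    refine Finset.sum_congr rfl fun i _ => ?_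
    rw [Finset.mul_sum, Matrix.trace_sum, Complex.re_sum]
    refine Finset.sum_congr rfl fun j _ => ?_
    rw [smul_mul_smul_comm, Matrix.mul_smul, Matrix.trace_smul, smul_eq_mul,
      ← Complex.ofReal_mul, Complex.re_ofReal_mul]
  rw [← hV, ← hquad]
  have hdot : u ⬝ᵥ w = ∑ j, w j * u j := by simp [dotProduct, mul_comm]
  rw [hdot]
  refine le_of_tendsto_of_tendsto' (((tendsto_finsetSum _ fun j _ =>
    (key j).const_mul (w j)).const_mul 2).sub_const _) (tendsto_integral_sq_approxOn hy hy2)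
    fun R => ?_
  rw [← hcross]
  exact M.integral_sq_simpleFunc_ge (hρ θ) hLH (yR R)

end CramerRao

/-! ## Measurements with finitely many outcomes -/

section FinitePOVM

variable {n : Type*} [Fintype n] [DecidableEq n] {X : Type*} [MeasurableSpace X]
variable {ι : Type*} [Fintype ι]

open Classical in
/-- The POVM with finitely many effects `E k` and outcomes `x k`. -/
def POVM.ofFintype (E : ι → Matrix n n ℂ) (hE : ∀ k, (E k).PosSemidef) (h1 : ∑ k, E k = 1)
    (x : ι → X) : POVM n X where
  effect s := ∑ k, if x k ∈ s then E k else 0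
  posSemidef s _ := Matrix.posSemidef_sum _ fun k _ => by
    split_ifs
    · exact hE k
    · exact Matrix.PosSemidef.zero
  effect_univ := by simpa using h1
  hasSum_iUnion f _ hd := by
    refine hasSum_sum fun k _ => ?_
    by_cases h : x k ∈ ⋃ i, f i
    · rw [if_pos h]
      obtain ⟨i, hi⟩ := Set.mem_iUnion.1 h
      have := hasSum_single (f := fun i => if x k ∈ f i then E k else 0) i fun j hj =>
        if_neg fun hj' => Set.disjoint_left.1 (hd hj) hj' hi
      simpa only [if_pos hi] using this
    · rw [if_neg h]
      have h' (i : ℕ) : x k ∉ f i := fun hi => h (Set.mem_iUnion.2 ⟨i, hi⟩)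
      simp only [h', if_false]
      exact hasSum_zero

variable {E : ι → Matrix n n ℂ} {hE : ∀ k, (E k).PosSemidef} {h1 : ∑ k, E k = 1} {x : ι → X}
  {ρ : Matrix n n ℂ}

theorem POVM.dist_ofFintype (hρ : ρ.PosSemidef) :
    (POVM.ofFintype E hE h1 x).dist ρ =
      ∑ k, ENNReal.ofReal (ρ * E k).trace.re • Measure.dirac (x k) := by
  ext s hs
  rw [POVM.dist_apply _ hρ hs, Measure.finsetSum_apply]
  simp only [POVM.ofFintype, Finset.mul_sum, Matrix.trace_sum, Complex.re_sum]
  rw [ENNReal.ofReal_sum_of_nonneg]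
  · refine Finset.sum_congr rfl fun k _ => ?_
    rw [Measure.smul_apply, Measure.dirac_apply' _ hs]
    by_cases h : x k ∈ s <;> simp [h]
  · intro k _
    split_ifs
    · exact trace_mul_re_nonneg hρ (hE k)
    · simp

variable [MeasurableSingletonClass X]

theorem POVM.integrable_dist_ofFintype (hρ : ρ.PosSemidef) (f : X → ℝ) :
    Integrable f ((POVM.ofFintype E hE h1 x).dist ρ) := by
  rw [POVM.dist_ofFintype hρ, integrable_finsetSum_measure]
  exact fun k _ => (integrable_dirac (by simp)).smul_measure ENNReal.ofReal_ne_top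

theorem POVM.integral_dist_ofFintype (hρ : ρ.PosSemidef) (f : X → ℝ) :
    ∫ y, f y ∂((POVM.ofFintype E hE h1 x).dist ρ) = ∑ k, (ρ * E k).trace.re * f (x k) := by
  rw [POVM.dist_ofFintype hρ, integral_finsetSum_measure fun k _ =>
    (integrable_dirac (by simp)).smul_measure ENNReal.ofReal_ne_top]
  refine Finset.sum_congr rfl fun k _ => ?_
  rw [integral_smul_measure, integral_dirac,
    ENNReal.toReal_ofReal (trace_mul_re_nonneg hρ (hE k)), smul_eq_mul]

end FinitePOVM

section LocallyUnbiased

variable {n : Type*} [Fintype n] [DecidableEq n] {d : ℕ} {ι : Type*} [Fintype ι]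

theorem HasEntryDerivAt.re_trace_mul {f : ℝ → Matrix n n ℂ} {f' : Matrix n n ℂ} {t : ℝ}
    (hf : HasEntryDerivAt f f' t) (A : Matrix n n ℂ) :
    HasDerivAt (fun s => (f s * A).trace.re) (f' * A).trace.re t := by
  have h := (hf.mul (HasEntryDerivAt.const A)).trace
  rw [Matrix.mul_zero, add_zero] at h
  exact Complex.reCLM.hasFDerivAt.comp_hasDerivAt t h

theorem isLocallyUnbiased_ofFintype {ρ : (Fin d → ℝ) → Matrix n n ℂ} {θ : Fin d → ℝ}
    (hρ : ∀ θ', (ρ θ').PosSemidef) (htr : ∀ θ', (ρ θ').trace = 1)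
    {ρ' : Fin d → Matrix n n ℂ}
    (hd : ∀ j, HasEntryDerivAt (fun t => ρ (update θ j t)) (ρ' j) (θ j))
    {E : ι → Matrix n n ℂ} (hE : ∀ k, (E k).PosSemidef) (h1 : ∑ k, E k = 1)
    (x : ι → Fin d → ℝ) (hx0 : ∀ i, ∑ k, (ρ θ * E k).trace.re * x k i = 0)
    (hx1 : ∀ i j, ∑ k, (ρ' j * E k).trace.re * x k i = if i = j then 1 else 0) :
    IsLocallyUnbiased ρ θ (POVM.ofFintype E hE h1 fun k => θ + x k) := by
  have hbias (θ' : Fin d → ℝ) (i : Fin d) :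
      bias ρ (POVM.ofFintype E hE h1 fun k => θ + x k) θ' i =
        ∑ k, (ρ θ' * E k).trace.re * x k i + (θ i - θ' i) := by
    have hs : ∑ k, (ρ θ' * E k).trace.re = 1 := by
      rw [← Complex.re_sum, ← Matrix.trace_sum, ← Finset.mul_sum, h1, mul_one, htr,
        Complex.one_re]
    rw [bias, POVM.integral_dist_ofFintype (hρ θ')]
    simp only [Pi.add_apply, mul_add, Finset.sum_add_distrib]
    rw [← Finset.sum_mul, hs]
    ring
  refine ⟨Eventually.of_forall fun θ' i => POVM.integrable_dist_ofFintype (hρ θ') _, ?_, ?_,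
    fun i j => POVM.integrable_dist_ofFintype (hρ θ) _⟩
  · intro i
    rw [hbias, hx0]
    ring
  · intro i j
    simp only [hbias]
    have hu : HasDerivAt (fun t => θ i - update θ j t i)
        (-((Pi.single j 1 : Fin d → ℝ) i)) (θ j) :=
      (hasDerivAt_pi.1 (hasDerivAt_update θ j (θ j)) i).const_sub _
    have h := (HasDerivAt.fun_sum (u := (Finset.univ : Finset ι)) fun k _ =>
      ((hd j).re_trace_mul (E k)).mul_const (x k i)).add hu
    refine h.congr_deriv ?_
    rw [hx1]
    simp [Pi.single_apply]

theorem mse_ofFintype {ρ : (Fin d → ℝ) → Matrix n n ℂ} {θ : Fin d → ℝ}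
    (hρ : (ρ θ).PosSemidef) {E : ι → Matrix n n ℂ} (hE : ∀ k, (E k).PosSemidef)
    (h1 : ∑ k, E k = 1) (x : ι → Fin d → ℝ) (i j : Fin d) :
    mse ρ (POVM.ofFintype E hE h1 fun k => θ + x k) θ i j =
      ∑ k, (ρ θ * E k).trace.re * (x k i * x k j) := by
  rw [mse, Matrix.of_apply, POVM.integral_dist_ofFintype hρ]
  simp

end LocallyUnbiased

/-! ## An optimal measurement for pure states with commuting tangent vectors -/

section Pure

open scoped Matrix

variable {n : Type*} [Fintype n] {d : ℕ}

theorem trace_mul_vecMulVec_star (A : Matrix n n ℂ) (g : n → ℂ) :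
    (A * Matrix.vecMulVec g (star g)).trace = star g ⬝ᵥ (A *ᵥ g) := by
  rw [Matrix.mul_vecMulVec, Matrix.trace_vecMulVec, dotProduct_comm]

theorem vecMulVec_mulVec_smul (u v w : n → ℂ) :
    Matrix.vecMulVec u v *ᵥ w = (v ⬝ᵥ w) • u := by
  ext a
  simp [Matrix.vecMulVec_mulVec, mul_comm]

theorem star_dotProduct_mulVec_of_isHermitian {L : Matrix n n ℂ} (hL : L.IsHermitian)
    (u v : n → ℂ) : star u ⬝ᵥ (L *ᵥ v) = star (L *ᵥ u) ⬝ᵥ v := by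
  rw [Matrix.star_mulVec, hL.eq, Matrix.dotProduct_mulVec]

/-- `Q` is an orthogonal projection, hence so is `1 - Q = (1 - Q)ᴴ (1 - Q)`. -/
theorem posSemidef_one_sub_sum_vecMulVec [DecidableEq n] {κ : Type*} [Fintype κ] [DecidableEq κ]
    {f : κ → n → ℂ} (hf : ∀ a b, star (f a) ⬝ᵥ f b = if a = b then 1 else 0) :
    (1 - ∑ a, Matrix.vecMulVec (f a) (star (f a))).PosSemidef := by
  set Q := ∑ a, Matrix.vecMulVec (f a) (star (f a)) with hQ
  have hH : Q.conjTranspose = Q := by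
    simp [hQ, Matrix.conjTranspose_sum, Matrix.conjTranspose_vecMulVec]
  have hQQ : Q * Q = Q := by
    rw [hQ, Finset.sum_mul_sum]
    refine Finset.sum_congr rfl fun a _ => ?_
    simp_rw [Matrix.vecMulVec_mul_vecMulVec, hf]
    simp [apply_ite (Matrix.vecMulVec (f a))]
  have h := Matrix.posSemidef_conjTranspose_mul_self (1 - Q)
  rwa [Matrix.conjTranspose_sub, Matrix.conjTranspose_one, hH, sub_mul, mul_sub, mul_sub, hQQ,
    one_mul, mul_one, one_mul, sub_self, sub_zero] at h

variable [DecidableEq n]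

theorem trace_vecMulVec_mul_symm {ψ : n → ℂ} {L : Matrix n n ℂ} (hL : L.IsHermitian)
    (g : n → ℂ) :
    ((1 / 2 : ℂ) • (Matrix.vecMulVec ψ (star ψ) * L + L * Matrix.vecMulVec ψ (star ψ)) *
        Matrix.vecMulVec g (star g)).trace.re =
      ((star g ⬝ᵥ ψ) * (star (L *ᵥ ψ) ⬝ᵥ g)).re := by
  have h1 : star g ⬝ᵥ ((Matrix.vecMulVec ψ (star ψ) * L) *ᵥ g) =
      (star g ⬝ᵥ ψ) * (star (L *ᵥ ψ) ⬝ᵥ g) := by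
    rw [← Matrix.mulVec_mulVec, vecMulVec_mulVec_smul, dotProduct_smul, smul_eq_mul, mul_comm,
      star_dotProduct_mulVec_of_isHermitian hL]
  have h2 : star g ⬝ᵥ ((L * Matrix.vecMulVec ψ (star ψ)) *ᵥ g) =
      star ((star g ⬝ᵥ ψ) * (star (L *ᵥ ψ) ⬝ᵥ g)) := by
    rw [← Matrix.mulVec_mulVec, vecMulVec_mulVec_smul, Matrix.mulVec_smul, dotProduct_smul,
      smul_eq_mul, star_mul', ← Matrix.star_dotProduct, ← Matrix.star_dotProduct]
  rw [trace_mul_vecMulVec_star, Matrix.smul_mulVec, Matrix.add_mulVec, dotProduct_smul,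
    dotProduct_add, h1, h2, smul_eq_mul]
  have h3 (z : ℂ) : (1 / 2 : ℂ) * (z + star z) = (z.re : ℂ) := by
    rw [Complex.re_eq_add_conj z, one_div_mul_eq_div]
    rfl
  rw [h3, Complex.ofReal_re]

/-- For a pure state whose tangent vectors have real inner products, some locally unbiased
measurement attains the quantum Cramér–Rao bound. -/
theorem exists_isLocallyUnbiased_mse_eq (hd0 : d ≠ 0) {ρ : (Fin d → ℝ) → Matrix n n ℂ}
    {θ : Fin d → ℝ} (hρ : ∀ θ', (ρ θ').PosSemidef) (htr : ∀ θ', (ρ θ').trace = 1)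
    {ψ : n → ℂ} (hψ : ρ θ = Matrix.vecMulVec ψ (star ψ))
    {L : Fin d → Matrix n n ℂ} (hL : ∀ j, (L j).IsHermitian)
    (hd : ∀ j, HasEntryDerivAt (fun t => ρ (update θ j t))
      ((1 / 2 : ℂ) • (ρ θ * L j + L j * ρ θ)) (θ j))
    (hL0 : ∀ j, (ρ θ * L j).trace = 0)
    {F : Matrix (Fin d) (Fin d) ℝ} (hF : F.PosDef)
    (hLF : ∀ i j, (ρ θ * (L i * L j)).trace = (F i j : ℂ)) :
    ∃ M, IsLocallyUnbiased ρ θ M ∧ mse ρ M θ = F⁻¹ := by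
  obtain ⟨B, hB⟩ : ∃ B : Matrix (Fin d) (Fin d) ℝ, F = Bᵀ * B := by
    open scoped MatrixOrder Matrix.Norms.L2Operator in
    obtain ⟨B, hB⟩ := CStarAlgebra.nonneg_iff_eq_star_mul_self.1 hF.posSemidef.nonneg
    exact ⟨B, by rw [hB, Matrix.star_eq_conjTranspose, Matrix.conjTranspose_eq_transpose_of_trivial]⟩
  have hBu : IsUnit B.det := by
    have h := hF.det_pos.ne'
    rw [hB, Matrix.det_mul] at h
    exact (right_ne_zero_of_mul h).isUnit
  set R := B⁻¹ with hR
  have hBR : B * R = 1 := Matrix.mul_nonsing_inv B hBu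
  have hRB : R * B = 1 := Matrix.nonsing_inv_mul B hBu
  have hFinv : F⁻¹ = R * Rᵀ := by
    rw [hB, Matrix.mul_inv_rev, ← Matrix.transpose_nonsing_inv]
  have hFR : Rᵀ * F = B := by
    rw [hB, ← Matrix.mul_assoc, ← Matrix.transpose_mul, hBR, Matrix.transpose_one, one_mul]
  let l : Fin d → n → ℂ := fun j => L j *ᵥ ψ
  -- Orthonormal, since the Gram matrix `F = Bᵀ B` of the `l j` is real and `R = B⁻¹`.
  let e : Fin d → n → ℂ := fun a => ∑ j, (R j a : ℂ) • l j
  have hψψ : star ψ ⬝ᵥ ψ = 1 := by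
    rw [← htr θ, hψ, Matrix.trace_vecMulVec, dotProduct_comm]
  have hψl (j : Fin d) : star ψ ⬝ᵥ l j = 0 := by
    rw [← hL0 j, hψ, Matrix.trace_mul_comm, trace_mul_vecMulVec_star]
  have hlψ (j : Fin d) : star (l j) ⬝ᵥ ψ = 0 := by
    rw [← star_dotProduct_mulVec_of_isHermitian (hL j), hψl]
  have hll (i j : Fin d) : star (l i) ⬝ᵥ l j = (F i j : ℂ) := by
    rw [← hLF, hψ, Matrix.trace_mul_comm, trace_mul_vecMulVec_star, ← Matrix.mulVec_mulVec,
      star_dotProduct_mulVec_of_isHermitian (hL i)]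
  have hle (j a : Fin d) : star (l j) ⬝ᵥ e a = (B a j : ℂ) := by
    simp only [e, dotProduct_sum, dotProduct_smul, hll, smul_eq_mul]
    rw [← hFR, Matrix.mul_apply]
    push_cast
    refine Finset.sum_congr rfl fun k _ => ?_
    rw [Matrix.transpose_apply, ← hF.isHermitian.apply j k]
    simp
  have hψe (a : Fin d) : star ψ ⬝ᵥ e a = 0 := by
    simp only [e, dotProduct_sum, dotProduct_smul, hψl, smul_zero, Finset.sum_const_zero]
  have heψ (a : Fin d) : star (e a) ⬝ᵥ ψ = 0 := by
    rw [Matrix.star_dotProduct, hψe, star_zero]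
  have hee (a b : Fin d) : star (e a) ⬝ᵥ e b = if a = b then 1 else 0 := by
    have h : star (e a) ⬝ᵥ e b = ((B * R) b a : ℝ) := by
      rw [show e a = ∑ j, (R j a : ℂ) • l j from rfl, Matrix.mul_apply]
      simp only [star_sum, star_smul, sum_dotProduct, smul_dotProduct, hle]
      push_cast
      exact Finset.sum_congr rfl fun k _ => by simp [mul_comm]
    rw [h, hBR, Matrix.one_apply]
    simp only [eq_comm (a := b)]
    split_ifs <;> simp
  set q := Real.sqrt d with hq
  have hqq : q * q = d := Real.mul_self_sqrt (Nat.cast_nonneg d)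
  have hq0 : q ≠ 0 := Real.sqrt_ne_zero'.2 (by positivity)
  let σ : Bool → ℝ := fun b => if b then 1 else -1
  -- For fixed `a`, the cross terms of the two signs cancel: half the sum of the two rank-one
  -- operators is `|ψ⟩⟨ψ|/d + |e a⟩⟨e a|`. Summing over `a` gives the projection onto the span of
  -- `ψ` and the `e a`; its complement is the extra effect `none`.
  let g : Fin d × Bool → n → ℂ := fun p => ((q⁻¹ : ℝ) : ℂ) • ψ + (σ p.2 : ℂ) • e p.1
  let f : Option (Fin d) → n → ℂ := fun o => o.elim ψ e
  have hf (a b : Option (Fin d)) : star (f a) ⬝ᵥ f b = if a = b then 1 else 0 := by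
    rcases a with _ | a <;> rcases b with _ | b <;> simp [f, hψψ, hψe, heψ, hee]
  let E : Option (Fin d × Bool) → Matrix n n ℂ := fun o =>
    o.elim (1 - ∑ a, Matrix.vecMulVec (f a) (star (f a)))
      fun p => ((1 / 2 : ℝ) : ℂ) • Matrix.vecMulVec (g p) (star (g p))
  have hE (k : Option (Fin d × Bool)) : (E k).PosSemidef := by
    rcases k with _ | p
    · exact posSemidef_one_sub_sum_vecMulVec hf
    · exact (Matrix.posSemidef_vecMulVec_self_star (g p)).smul
        (Complex.zero_le_real.2 (by norm_num))
  have h1 : ∑ k, E k = 1 := by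
    have hpair (a : Fin d) : E (some (a, true)) + E (some (a, false)) =
        ((d : ℂ)⁻¹) • Matrix.vecMulVec ψ (star ψ) + Matrix.vecMulVec (e a) (star (e a)) := by
      have : (d : ℂ)⁻¹ = (q : ℂ)⁻¹ * (q : ℂ)⁻¹ := by
        rw [← mul_inv, ← Complex.ofReal_mul, hqq, Complex.ofReal_natCast]
      ext x y
      simp [E, g, σ, Matrix.vecMulVec_apply, this]
      ring
    rw [Fintype.sum_option, Fintype.sum_prod_type]
    simp only [Fintype.sum_bool, hpair, Finset.sum_add_distrib]
    simp only [E, f, Option.elim, Fintype.sum_option, Finset.sum_const, Finset.card_univ,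
      Fintype.card_fin]
    rw [← Nat.cast_smul_eq_nsmul ℂ, smul_smul, mul_inv_cancel₀ (by exact_mod_cast hd0), one_smul]
    abel
  have hgψ (p : Fin d × Bool) : star (g p) ⬝ᵥ ψ = ((q⁻¹ : ℝ) : ℂ) := by
    simp [g, add_dotProduct, smul_dotProduct, hψψ, heψ]
  have hψg (p : Fin d × Bool) : star ψ ⬝ᵥ g p = ((q⁻¹ : ℝ) : ℂ) := by
    simp [g, dotProduct_add, dotProduct_smul, hψψ, hψe]
  have hlg (j : Fin d) (p : Fin d × Bool) :
      star (l j) ⬝ᵥ g p = ((σ p.2 * B p.1 j : ℝ) : ℂ) := by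
    simp [g, dotProduct_add, dotProduct_smul, hlψ, hle]
  have hprob (p : Fin d × Bool) : (ρ θ * E (some p)).trace.re = (2 * d : ℝ)⁻¹ := by
    simp only [E, Option.elim]
    rw [Matrix.mul_smul, Matrix.trace_smul, smul_eq_mul, Complex.re_ofReal_mul,
      trace_mul_vecMulVec_star, hψ, vecMulVec_mulVec_smul, dotProduct_smul, hψg, hgψ, smul_eq_mul,
      ← Complex.ofReal_mul, Complex.ofReal_re, ← mul_inv, hqq]
    ring
  have hderiv (j : Fin d) (p : Fin d × Bool) :
      ((1 / 2 : ℂ) • (ρ θ * L j + L j * ρ θ) * E (some p)).trace.re =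
        (1 / 2) * (q⁻¹ * (σ p.2 * B p.1 j)) := by
    simp only [E, Option.elim]
    rw [Matrix.mul_smul, Matrix.trace_smul, smul_eq_mul, Complex.re_ofReal_mul, hψ,
      trace_vecMulVec_mul_symm (hL j), hgψ, hlg, ← Complex.ofReal_mul, Complex.ofReal_re]
  -- Each `some p` has probability `1/(2d)` with `j`-th derivative `σ B_aj / (2q)`. The scale `q =
  -- √d` makes the response `R B = 1` and the covariance `R Rᵀ = F⁻¹`. The outcome `none` reports
  -- `θ` itself and drops out of all sums.
  let x : Option (Fin d × Bool) → Fin d → ℝ := fun o =>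
    o.elim 0 fun p i => σ p.2 * (q * R i p.1)
  refine ⟨POVM.ofFintype E hE h1 fun k => θ + x k,
    isLocallyUnbiased_ofFintype hρ htr hd hE h1 x ?_ ?_, ?_⟩
  · intro i
    rw [Fintype.sum_option, Fintype.sum_prod_type]
    simp [x, hprob, σ]
  · intro i j
    rw [Fintype.sum_option, Fintype.sum_prod_type]
    have h := congrFun (congrFun hRB i) j
    rw [Matrix.mul_apply, Matrix.one_apply] at h
    rw [← h]
    simp only [hderiv, Fintype.sum_bool]
    simp only [x, σ, Option.elim, Pi.zero_apply, mul_zero, zero_add]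
    refine Finset.sum_congr rfl fun a _ => ?_
    simp only [if_true, Bool.false_eq_true, if_false]
    field_simp
    ring
  · ext i j
    rw [mse_ofFintype (hρ θ), Fintype.sum_option, Fintype.sum_prod_type, hFinv, Matrix.mul_apply]
    simp only [hprob, Fintype.sum_bool]
    simp only [x, σ, Option.elim, Pi.zero_apply, mul_zero, zero_add]
    refine Finset.sum_congr rfl fun a _ => ?_
    have : (d : ℝ) ≠ 0 := by exact_mod_cast hd0
    simp only [if_true, Bool.false_eq_true, if_false, Matrix.transpose_apply]
    rw [← hqq]
    field_simp
    ring

end Pure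

/-! ## Pure models -/

section PureModel

open scoped Matrix

variable {n : Type*} [Fintype n] [DecidableEq n] {d : ℕ}

/-- A tangent direction `q` to the idempotents at `p` is off-diagonal with respect to `p`. -/
theorem mul_mul_self_eq_zero_of_isIdempotentElem {R : Type*} [Ring R] {p q : R}
    (hp : p * p = p) (hq : q * p + p * q = q) : p * q * p = 0 := by
  have h : p * (q * p + p * q) * p = p * q * p := by rw [hq]
  have h' : p * (q * p + p * q) * p = p * q * (p * p) + (p * p) * q * p := by noncomm_ring
  rw [h', hp] at h
  exact add_eq_left.1 h

/-- Differentiating `ρ² = ρ` gives `ρ' = ρ' ρ + ρ ρ'`, so `2ρ'` solves the defining equation. -/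
theorem isSLD_of_isIdempotentElem {ρ : (Fin d → ℝ) → Matrix n n ℂ} {θ : Fin d → ℝ} {i : Fin d}
    (hH : ∀ θ', (ρ θ').IsHermitian) (hρ : ∀ θ', ρ θ' * ρ θ' = ρ θ') {ρ' : Matrix n n ℂ}
    (hd : HasEntryDerivAt (fun t => ρ (update θ i t)) ρ' (θ i)) :
    IsSLD ρ θ i ((2 : ℂ) • ρ') := by
  have h1 : ρ' * ρ θ + ρ θ * ρ' = ρ' := by
    have h := hd.mul hd
    simp only [hρ, update_eq_self] at h
    exact h.unique hd
  have h2 : ρ'.conjTranspose = ρ' := by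
    have h := hd.conjTranspose
    simp only [(hH _).eq] at h
    exact h.unique hd
  refine ⟨?_, ?_⟩
  · simp [Matrix.IsHermitian, Matrix.conjTranspose_smul, h2]
  · rw [hd.pderiv_eq, Matrix.mul_smul, Matrix.smul_mul, ← smul_add, smul_smul, add_comm, h1]
    norm_num

theorem isSLD_sld {ρ : (Fin d → ℝ) → Matrix n n ℂ} {θ : Fin d → ℝ} {i : Fin d}
    (h : ∃ L, IsSLD ρ θ i L) : IsSLD ρ θ i (sld ρ θ i) := by
  rw [sld, dif_pos h]
  exact h.choose_spec

/-- A logarithmic derivative of a pure model is not unique, but its action on the state is. Hence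
nothing below depends on the choice made in `sld`. -/
theorem sld_mul_of_isIdempotentElem {p q L : Matrix n n ℂ} (hp : p * p = p)
    (hq : q * p + p * q = q) (hL : q = (1 / 2 : ℂ) • (p * L + L * p)) :
    L * p = (2 : ℂ) • (q * p) := by
  have h0 := mul_mul_self_eq_zero_of_isIdempotentElem hp hq
  have h1 : (2 : ℂ) • q = p * L + L * p := by
    rw [hL, smul_smul]; norm_num
  have h2 : p * ((2 : ℂ) • q) * p = p * L * p + p * L * p := by
    rw [h1]
    calc p * (p * L + L * p) * p = (p * p) * L * p + p * L * (p * p) := by noncomm_ring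
      _ = _ := by rw [hp]
  rw [Matrix.mul_smul, Matrix.smul_mul, h0, smul_zero, ← two_smul ℂ] at h2
  have h3 : p * L * p = 0 := (smul_eq_zero.1 h2.symm).resolve_left two_ne_zero
  rw [← Matrix.smul_mul, h1, add_mul, h3, zero_add, mul_assoc, hp]

/-- A model of pure states, differentiable in every parameter at `θ`. -/
structure IsPureModel (ρ : (Fin d → ℝ) → Matrix n n ℂ) (θ : Fin d → ℝ)
    (Φ : (Fin d → ℝ) → n → ℂ) (ρ' : Fin d → Matrix n n ℂ) : Prop where
  eq_vecMulVec : ∀ θ', ρ θ' = Matrix.vecMulVec (Φ θ') (star (Φ θ'))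
  star_dotProduct_self : ∀ θ', star (Φ θ') ⬝ᵥ Φ θ' = 1
  hasEntryDerivAt : ∀ j, HasEntryDerivAt (fun t => ρ (update θ j t)) (ρ' j) (θ j)

namespace IsPureModel

variable {ρ : (Fin d → ℝ) → Matrix n n ℂ} {θ : Fin d → ℝ} {Φ : (Fin d → ℝ) → n → ℂ}
  {ρ' : Fin d → Matrix n n ℂ}

theorem posSemidef (h : IsPureModel ρ θ Φ ρ') (θ' : Fin d → ℝ) : (ρ θ').PosSemidef := by
  rw [h.eq_vecMulVec]
  exact Matrix.posSemidef_vecMulVec_self_star _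

theorem trace_eq_one (h : IsPureModel ρ θ Φ ρ') (θ' : Fin d → ℝ) : (ρ θ').trace = 1 := by
  rw [h.eq_vecMulVec, Matrix.trace_vecMulVec, dotProduct_comm, h.star_dotProduct_self]

theorem mul_self (h : IsPureModel ρ θ Φ ρ') (θ' : Fin d → ℝ) : ρ θ' * ρ θ' = ρ θ' := by
  rw [h.eq_vecMulVec, Matrix.vecMulVec_mul_vecMulVec, h.star_dotProduct_self, one_smul]

theorem deriv_mul_add (h : IsPureModel ρ θ Φ ρ') (j : Fin d) :
    ρ' j * ρ θ + ρ θ * ρ' j = ρ' j := by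
  have h1 := (h.hasEntryDerivAt j).mul (h.hasEntryDerivAt j)
  simp only [h.mul_self, update_eq_self] at h1
  exact h1.unique (h.hasEntryDerivAt j)

theorem isSLD (h : IsPureModel ρ θ Φ ρ') (j : Fin d) : IsSLD ρ θ j (sld ρ θ j) :=
  isSLD_sld ⟨_, isSLD_of_isIdempotentElem (fun θ' => (h.posSemidef θ').isHermitian) h.mul_self
    (h.hasEntryDerivAt j)⟩

theorem deriv_eq (h : IsPureModel ρ θ Φ ρ') (j : Fin d) :
    ρ' j = (1 / 2 : ℂ) • (ρ θ * sld ρ θ j + sld ρ θ j * ρ θ) := by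
  rw [← (h.isSLD j).2, (h.hasEntryDerivAt j).pderiv_eq]

theorem sld_mul (h : IsPureModel ρ θ Φ ρ') (j : Fin d) :
    sld ρ θ j * ρ θ = (2 : ℂ) • (ρ' j * ρ θ) :=
  sld_mul_of_isIdempotentElem (h.mul_self θ) (h.deriv_mul_add j) (h.deriv_eq j)

theorem mul_sld (h : IsPureModel ρ θ Φ ρ') (j : Fin d) :
    ρ θ * sld ρ θ j = (2 : ℂ) • (ρ θ * ρ' j) := by
  have h1 : (2 : ℂ) • ρ' j = ρ θ * sld ρ θ j + sld ρ θ j * ρ θ := by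
    conv_lhs => rw [h.deriv_eq j]
    rw [smul_smul]
    norm_num
  have h2 : ρ θ * sld ρ θ j = (2 : ℂ) • ρ' j - sld ρ θ j * ρ θ := by rw [h1]; abel
  rw [h2, h.sld_mul, ← smul_sub]
  congr 1
  rw [sub_eq_iff_eq_add', h.deriv_mul_add]

theorem trace_mul_sld (h : IsPureModel ρ θ Φ ρ') (j : Fin d) : (ρ θ * sld ρ θ j).trace = 0 := by
  have h1 := (h.hasEntryDerivAt j).trace
  simp only [h.trace_eq_one] at h1
  have h2 : (ρ' j).trace = 0 := h1.unique (hasDerivAt_const _ _)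
  rw [h.deriv_eq j, Matrix.trace_smul, Matrix.trace_add,
    Matrix.trace_mul_comm (sld ρ θ j) (ρ θ), ← two_mul, smul_eq_mul] at h2
  simpa using h2

theorem trace_mul_sld_mul_sld (h : IsPureModel ρ θ Φ ρ') (i j : Fin d) :
    (ρ θ * (sld ρ θ i * sld ρ θ j)).trace = 4 * (ρ θ * ρ' i * ρ' j).trace := by
  have h1 : (ρ θ * (sld ρ θ i * sld ρ θ j)).trace =
      ((ρ θ * sld ρ θ i) * (sld ρ θ j * ρ θ)).trace := by
    rw [← Matrix.mul_assoc, ← Matrix.mul_assoc, Matrix.trace_mul_comm _ (ρ θ), ← Matrix.mul_assoc,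
      ← Matrix.mul_assoc, h.mul_self]
  have h2 : (ρ θ * ρ' i * ρ' j).trace = ((ρ θ * ρ' i) * (ρ' j * ρ θ)).trace := by
    rw [← Matrix.mul_assoc, Matrix.trace_mul_comm _ (ρ θ), ← Matrix.mul_assoc, ← Matrix.mul_assoc,
      h.mul_self]
  rw [h1, h2, h.mul_sld, h.sld_mul, smul_mul_smul_comm, Matrix.trace_smul, smul_eq_mul]
  norm_num

/-- Exchanging `i` and `j` conjugates the trace, while `A = 0` makes it symmetric; so it is real. -/
theorem trace_mul_sld_mul_sld_eq_qfi (h : IsPureModel ρ θ Φ ρ') (hA : commMatrix ρ θ = 0)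
    (i j : Fin d) : (ρ θ * (sld ρ θ i * sld ρ θ j)).trace = (qfi ρ θ i j : ℂ) := by
  have h1 : (ρ θ * (sld ρ θ i * sld ρ θ j)).trace = (ρ θ * (sld ρ θ j * sld ρ θ i)).trace := by
    have h2 := congrFun (congrFun hA i) j
    simp only [commMatrix, Matrix.of_apply, Matrix.zero_apply, mul_eq_zero] at h2
    rw [Matrix.mul_sub, Matrix.trace_sub, sub_eq_zero] at h2
    exact h2.resolve_left (by simp)
  have h3 : star (ρ θ * (sld ρ θ i * sld ρ θ j)).trace =
      (ρ θ * (sld ρ θ j * sld ρ θ i)).trace := by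
    rw [← Matrix.trace_conjTranspose, Matrix.conjTranspose_mul, Matrix.conjTranspose_mul,
      (h.posSemidef θ).isHermitian.eq, (h.isSLD i).1.eq, (h.isSLD j).1.eq, Matrix.trace_mul_comm]
  rw [qfi, Matrix.of_apply, Matrix.mul_add, Matrix.trace_add, ← h1, ← two_mul]
  rw [← h1] at h3
  have h4 := Complex.conj_eq_iff_re.1 h3
  conv_lhs => rw [← h4]
  congr 1
  simp

/-- The tangent operators of `N` copies of the model. -/
theorem copies (h : IsPureModel ρ θ Φ ρ') (N : ℕ) :
    IsPureModel (QEst.copies N ρ) θ (fun θ' a => ∏ k, Φ θ' (a k)) fun j =>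
      (1 / 2 : ℂ) • (QEst.copies N ρ θ * (∑ k, site k (sld ρ θ j)) +
        (∑ k, site k (sld ρ θ j)) * QEst.copies N ρ θ) := by
  have h0 (θ' : Fin d → ℝ) : QEst.copies N ρ θ' =
      Matrix.vecMulVec (fun a => ∏ k, Φ θ' (a k)) (star fun a => ∏ k, Φ θ' (a k)) := by
    rw [QEst.copies, h.eq_vecMulVec θ']
    exact tensor_vecMulVec fun _ => Φ θ'
  refine ⟨h0, fun θ' => ?_, fun j => ?_⟩
  · have h1 : (QEst.copies N ρ θ').trace = 1 := by
      rw [QEst.copies, trace_tensor]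
      simp [h.trace_eq_one]
    rw [← h1, h0, Matrix.trace_vecMulVec, dotProduct_comm]
  · have h1 := (h.hasEntryDerivAt j).tensor (κ := Fin N)
    simp only [update_eq_self] at h1
    have h2 : (1 / 2 : ℂ) • (QEst.copies N ρ θ * (∑ k, site k (sld ρ θ j)) +
        (∑ k, site k (sld ρ θ j)) * QEst.copies N ρ θ) =
        ∑ k, tensor (update (fun _ => ρ θ) k (ρ' j)) := by
      rw [Finset.mul_sum, Finset.sum_mul, ← Finset.sum_add_distrib, Finset.smul_sum]
      refine Finset.sum_congr rfl fun k _ => ?_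
      rw [QEst.copies, tensor_mul_site, site_mul_tensor, ← tensor_update_add,
        ← tensor_update_smul, ← h.deriv_eq j]
    rw [h2]
    exact h1

/-- The optimal measurement on `N` copies makes the ratio at most one for all weights at once.
Conversely, a single rank-one weight `u uᵀ` turns Cramér–Rao into a ratio of at least one. -/
theorem rN_eq_one (h : IsPureModel ρ θ Φ ρ') (hd : d ≠ 0) (hA : commMatrix ρ θ = 0)
    (hF : (qfi ρ θ).PosDef) {N : ℕ} (hN : N ≠ 0) : rN N ρ θ = 1 := by
  have hc := h.copies N
  have hN0 : (0 : ℝ) < N := by positivity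
  have hL (j : Fin d) : (∑ k : Fin N, site k (sld ρ θ j)).IsHermitian := by
    simp [Matrix.IsHermitian, Matrix.conjTranspose_sum, conjTranspose_site, (h.isSLD j).1.eq]
  have hLF (i j : Fin d) : (QEst.copies N ρ θ * ((∑ k : Fin N, site k (sld ρ θ i)) *
      ∑ k : Fin N, site k (sld ρ θ j))).trace = (((N : ℝ) • qfi ρ θ) i j : ℝ) := by
    rw [QEst.copies, trace_tensor_mul_sum_site_mul_sum_site _ _ _ (h.trace_eq_one θ)
      (h.trace_mul_sld i), h.trace_mul_sld_mul_sld_eq_qfi hA]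
    simp
  have hFdet : IsUnit (qfi ρ θ).det := hF.det_pos.ne'.isUnit
  apply le_antisymm
  · have hL0 (j : Fin d) : (QEst.copies N ρ θ * ∑ k : Fin N, site k (sld ρ θ j)).trace = 0 := by
      rw [QEst.copies, Finset.mul_sum, Matrix.trace_sum]
      refine Finset.sum_eq_zero fun k _ => ?_
      rw [tensor_mul_site, trace_tensor_update _ _ _ fun _ => h.trace_eq_one θ, h.trace_mul_sld]
    obtain ⟨M, hM, hmse⟩ := exists_isLocallyUnbiased_mse_eq hd hc.posSemidef hc.trace_eq_one
      (hc.eq_vecMulVec θ) hL hc.hasEntryDerivAt hL0 (hF.smul hN0) hLF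
    refine (iInf₂_le M hM).trans (iSup₂_le fun G _ => ?_)
    have hinv : ((N : ℝ) • qfi ρ θ)⁻¹ = (N : ℝ)⁻¹ • (qfi ρ θ)⁻¹ := by
      rw [Matrix.inv_eq_right_inv]
      rw [smul_mul_smul_comm, mul_inv_cancel₀ hN0.ne', Matrix.mul_nonsing_inv _ hFdet, one_smul]
    rw [hmse, hinv, Matrix.mul_smul, Matrix.trace_smul, smul_eq_mul, ← mul_assoc,
      mul_inv_cancel₀ hN0.ne', one_mul]
    -- The ratio is `t / t`, at most one even when `t = 0`, so positivity of `Tr[G F⁻¹]` is not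
    -- needed.
    exact_mod_cast div_self_le_one _
  · refine le_iInf₂ fun M hM => ?_
    obtain ⟨i₀⟩ : Nonempty (Fin d) := ⟨⟨0, Nat.pos_of_ne_zero hd⟩⟩
    let u : Fin d → ℝ := Pi.single i₀ 1
    have hu : u ≠ 0 := by simp [u]
    let w : Fin d → ℝ := (qfi ρ θ)⁻¹ *ᵥ u
    have hw : 0 < u ⬝ᵥ w := by simpa using hF.inv.dotProduct_mulVec_pos hu
    have hFw : (qfi ρ θ) *ᵥ w = u := by
      rw [Matrix.mulVec_mulVec, Matrix.mul_nonsing_inv _ hFdet, Matrix.one_mulVec]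
    have htr (A : Matrix (Fin d) (Fin d) ℝ) :
        (Matrix.vecMulVec u u * A).trace = u ⬝ᵥ (A *ᵥ u) := by
      rw [Matrix.trace_mul_comm, Matrix.mul_vecMulVec, Matrix.trace_vecMulVec, dotProduct_comm]
    have hdot (A : Matrix (Fin d) (Fin d) ℝ) (x : Fin d → ℝ) :
        x ⬝ᵥ (A *ᵥ x) = ∑ i, ∑ j, x i * x j * A i j := by
      simp only [dotProduct, Matrix.mulVec, Finset.mul_sum]
      exact Finset.sum_congr rfl fun i _ => Finset.sum_congr rfl fun j _ => by ring
    -- The second vector is `(N F)⁻¹ u`, the maximiser of the bound for `N` copies.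
    have hCR := hM.cramerRao hc.posSemidef hc.trace_eq_one hL hc.hasEntryDerivAt u
      ((N : ℝ)⁻¹ • w)
    simp only [hLF, Complex.ofReal_re] at hCR
    rw [← hdot, ← hdot, Matrix.smul_mulVec, Matrix.mulVec_smul, hFw, smul_smul,
      mul_inv_cancel₀ hN0.ne', one_smul, smul_dotProduct, dotProduct_smul, dotProduct_comm w u,
      smul_eq_mul] at hCR
    refine le_trans ?_ (le_iSup₂ (Matrix.vecMulVec u u) ⟨?_, ?_⟩)
    · rw [htr, htr]
      have : (1 : ℝ) ≤ N * (u ⬝ᵥ (mse (QEst.copies N ρ) M θ *ᵥ u)) / (u ⬝ᵥ w) := by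
        rw [le_div_iff₀ hw, one_mul]
        have h2 : (N : ℝ)⁻¹ * (u ⬝ᵥ w) ≤ u ⬝ᵥ (mse (QEst.copies N ρ) M θ *ᵥ u) := by linarith
        rwa [inv_mul_le_iff₀ hN0] at h2
      exact_mod_cast this
    · simpa using Matrix.posSemidef_vecMulVec_self_star u
    · intro h0
      have := congrFun (congrFun h0 i₀) i₀
      simp [u, Matrix.vecMulVec_apply] at this

theorem incompatibility_eq_zero (h : IsPureModel ρ θ Φ ρ') (hd : d ≠ 0)
    (hA : commMatrix ρ θ = 0) (hF : (qfi ρ θ).PosDef) : incompatibility ρ θ = 0 := by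
  have h1 : liminf (fun N : ℕ => rN N ρ θ) atTop = 1 := by
    have h2 : (fun N : ℕ => rN N ρ θ) =ᶠ[atTop] fun _ => 1 := by
      filter_upwards [eventually_ne_atTop 0] with N hN
      exact h.rN_eq_one hd hA hF hN
    rw [liminf_congr h2, liminf_const]
  rw [incompatibility, h1]
  rw [← EReal.coe_one, ← EReal.coe_sub, sub_self, EReal.coe_zero]

end IsPureModel

end PureModel

/-! ## Models generated by unitary encodings -/

section Encoding

open scoped Matrix

variable {d D : ℕ} {H : Fin d → Matrix (Fin D) (Fin D) ℂ}

theorem conjTranspose_encodingU (hH : ∀ j, (H j).IsHermitian) (θ : Fin d → ℝ) :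
    (encodingU H θ)ᴴ = encodingU H (-θ) := by
  rw [encodingU, encodingU, ← Matrix.exp_conjTranspose]
  congr 1
  simp [Matrix.conjTranspose_smul, Matrix.conjTranspose_sum, (hH _).eq]

theorem encodingU_neg_mul (θ : Fin d → ℝ) : encodingU H (-θ) * encodingU H θ = 1 := by
  have h : Complex.I • ∑ j, ((-θ) j : ℂ) • H j = -(Complex.I • ∑ j, (θ j : ℂ) • H j) := by
    simp
  rw [encodingU, encodingU, h, Matrix.exp_neg]
  exact Matrix.nonsing_inv_mul _ ((Matrix.isUnit_iff_isUnit_det _).1 (Matrix.isUnit_exp _))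

theorem encodingU_mul_neg (θ : Fin d → ℝ) : encodingU H θ * encodingU H (-θ) = 1 :=
  mul_eq_one_comm.1 (encodingU_neg_mul θ)

open scoped Matrix.Norms.Operator in
theorem exists_hasEntryDerivAt_encodingU (H : Fin d → Matrix (Fin D) (Fin D) ℂ) (θ : Fin d → ℝ)
    (j : Fin d) : ∃ U', HasEntryDerivAt (fun t => encodingU H (update θ j t)) U' (θ j) := by
  have h1 : DifferentiableAt ℝ
      (fun t : ℝ => Complex.I • ∑ k, (update θ j t k : ℂ) • H k) (θ j) := by
    refine DifferentiableAt.fun_const_smul (DifferentiableAt.fun_sum fun k _ => ?_) Complex.I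
    refine DifferentiableAt.smul_const ?_ _
    have h2 : DifferentiableAt ℝ (fun t : ℝ => update θ j t k) (θ j) :=
      (hasDerivAt_pi.1 (hasDerivAt_update θ j (θ j)) k).differentiableAt
    exact Complex.ofRealCLM.differentiableAt.comp (θ j) h2
  have h3 : DifferentiableAt ℝ (fun t : ℝ => encodingU H (update θ j t)) (θ j) :=
    (NormedSpace.exp_analytic (𝕂 := ℝ) _).differentiableAt.comp (θ j) h1
  refine ⟨deriv (fun t : ℝ => encodingU H (update θ j t)) (θ j), fun a b => ?_⟩
  exact (LinearMap.toContinuousLinearMap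
    (Matrix.entryLinearMap ℝ ℂ a b)).hasFDerivAt.comp_hasDerivAt (θ j) h3.hasDerivAt

theorem hasEntryDerivAt_encodingU (H : Fin d → Matrix (Fin D) (Fin D) ℂ) (θ : Fin d → ℝ)
    (j : Fin d) : HasEntryDerivAt (fun t => encodingU H (update θ j t))
      (Complex.I • (encodingU H θ * heff H θ j)) (θ j) := by
  obtain ⟨U', hU'⟩ := exists_hasEntryDerivAt_encodingU H θ j
  have h1 := (HasEntryDerivAt.const (encodingU H (-θ))).mul hU'
  rw [Matrix.zero_mul, zero_add] at h1
  have h2 : heff H θ j = -Complex.I • (encodingU H (-θ) * U') := by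
    rw [heff]
    congr 1
    exact HasEntryDerivAt.pderiv_eq (f := fun θ' => encodingU H (-θ) * encodingU H θ') h1
  have h3 : Complex.I • (encodingU H θ * heff H θ j) = U' := by
    rw [h2, Matrix.mul_smul, smul_smul, ← Matrix.mul_assoc, encodingU_mul_neg, Matrix.one_mul]
    simp
  rwa [h3]

/-- Differentiate `Uᴴ U = 1`. -/
theorem isHermitian_heff (hH : ∀ j, (H j).IsHermitian) (θ : Fin d → ℝ) (j : Fin d) :
    (heff H θ j).IsHermitian := by
  have h1 := hasEntryDerivAt_encodingU H θ j
  have h2 := h1.conjTranspose.mul h1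
  simp only [update_eq_self, conjTranspose_encodingU hH, encodingU_neg_mul] at h2
  have h3 := h2.unique (HasEntryDerivAt.const 1)
  rw [Matrix.conjTranspose_smul, Matrix.conjTranspose_mul, conjTranspose_encodingU hH,
    Matrix.smul_mul, Matrix.mul_smul, Matrix.mul_assoc, encodingU_neg_mul, ← Matrix.mul_assoc,
    encodingU_neg_mul, Matrix.mul_one, Matrix.one_mul] at h3
  have h4 : Complex.I • (heff H θ j - (heff H θ j)ᴴ) = 0 := by
    rw [← h3, smul_sub]
    simp only [Complex.star_def, Complex.conj_I, neg_smul]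
    abel
  exact (sub_eq_zero.1 ((smul_eq_zero.1 h4).resolve_left Complex.I_ne_zero)).symm

variable {κ : Type*} [Fintype κ] [DecidableEq κ]

/-- The product state `⨂ₖ |ψₖ⟩⟨ψₖ|`. -/
def productState (ψ : κ → EuclideanSpace ℂ (Fin D)) : Matrix (κ → Fin D) (κ → Fin D) ℂ :=
  Matrix.vecMulVec (tensorVec ψ) (star (tensorVec ψ))

theorem productState_eq_tensor (ψ : κ → EuclideanSpace ℂ (Fin D)) :
    productState ψ = tensor fun k => Matrix.vecMulVec (ψ k).ofLp (star (ψ k).ofLp) :=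
  (tensor_vecMulVec fun k => (ψ k).ofLp).symm

theorem trace_vecMulVec_star_mul (φ : EuclideanSpace ℂ (Fin D)) (C : Matrix (Fin D) (Fin D) ℂ) :
    (Matrix.vecMulVec φ.ofLp (star φ.ofLp) * C).trace = inner ℂ φ (Matrix.toEuclideanLin C φ) := by
  rw [Matrix.trace_mul_comm, trace_mul_vecMulVec_star, EuclideanSpace.inner_eq_star_dotProduct,
    dotProduct_comm]
  rfl

theorem trace_vecMulVec_star (φ : EuclideanSpace ℂ (Fin D)) (hφ : ‖φ‖ = 1) :
    (Matrix.vecMulVec φ.ofLp (star φ.ofLp)).trace = 1 := by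
  have h := trace_vecMulVec_star_mul φ 1
  rw [Matrix.mul_one] at h
  rw [h, show Matrix.toEuclideanLin (1 : Matrix (Fin D) (Fin D) ℂ) φ = φ by
    simp [Matrix.toLpLin_one], inner_self_eq_norm_sq_to_K, hφ]
  simp

theorem trace_productState {ψ : κ → EuclideanSpace ℂ (Fin D)} (hψ : ∀ k, ‖ψ k‖ = 1) :
    (productState ψ).trace = 1 := by
  rw [productState_eq_tensor, trace_tensor]
  exact Finset.prod_eq_one fun k _ => trace_vecMulVec_star _ (hψ k)

theorem productState_mul_self {ψ : κ → EuclideanSpace ℂ (Fin D)} (hψ : ∀ k, ‖ψ k‖ = 1) :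
    productState ψ * productState ψ = productState ψ := by
  have h := trace_productState hψ
  rw [productState, Matrix.trace_vecMulVec, dotProduct_comm] at h
  rw [productState, Matrix.vecMulVec_mul_vecMulVec, h, one_smul]

theorem trace_productState_mul_sum_site {ψ : κ → EuclideanSpace ℂ (Fin D)}
    (hψ : ∀ k, ‖ψ k‖ = 1) (C : Matrix (Fin D) (Fin D) ℂ) :
    (productState ψ * ∑ k, site k C).trace =
      ∑ k, inner ℂ (ψ k) (Matrix.toEuclideanLin C (ψ k)) := by
  rw [productState_eq_tensor, Finset.mul_sum, Matrix.trace_sum]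
  refine Finset.sum_congr rfl fun k _ => ?_
  rw [tensor_mul_site, trace_tensor_update _ _ _ fun l => trace_vecMulVec_star _ (hψ l),
    trace_vecMulVec_star_mul]

/-- The total effective generator `∑ₖ Hⱼ^eff(θ)` of the encoding of the `κ`-fold probe. -/
def totalHeff (κ : Type*) [Fintype κ] [DecidableEq κ] (H : Fin d → Matrix (Fin D) (Fin D) ℂ)
    (θ : Fin d → ℝ) (j : Fin d) : Matrix (κ → Fin D) (κ → Fin D) ℂ :=
  ∑ k, site k (heff H θ j)

theorem isPureModel_productModel (hH : ∀ j, (H j).IsHermitian) (θ : Fin d → ℝ)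
    {ψ : κ → EuclideanSpace ℂ (Fin D)} (hψ : ∀ k, ‖ψ k‖ = 1) :
    IsPureModel (productModel H ψ) θ
      (fun θ' => tensor (fun _ : κ => encodingU H θ') *ᵥ tensorVec ψ) fun j =>
        tensor (fun _ : κ => encodingU H θ) *
          (Complex.I • (totalHeff κ H θ j * productState ψ - productState ψ * totalHeff κ H θ j)) *
          (tensor fun _ : κ => encodingU H θ)ᴴ := by
  have hW (θ' : Fin d → ℝ) : (tensor fun _ : κ => encodingU H θ')ᴴ *
      (tensor fun _ : κ => encodingU H θ') = 1 := by
    rw [conjTranspose_tensor, tensor_mul]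
    simp only [conjTranspose_encodingU hH, encodingU_neg_mul, tensor_one]
  refine ⟨fun θ' => ?_, fun θ' => ?_, fun j => ?_⟩
  · rw [productModel, Matrix.mul_vecMulVec, Matrix.vecMulVec_mul, Matrix.star_mulVec]
  · rw [Matrix.star_mulVec, ← Matrix.dotProduct_mulVec, Matrix.mulVec_mulVec, hW,
      Matrix.one_mulVec, ← trace_productState hψ, productState, Matrix.trace_vecMulVec,
      dotProduct_comm]
  · have h1 := (hasEntryDerivAt_encodingU H θ j).tensor (κ := κ)
    simp only [update_eq_self] at h1
    have h2 : ∑ k : κ, tensor (update (fun _ : κ => encodingU H θ) k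
        (Complex.I • (encodingU H θ * heff H θ j))) =
        Complex.I • (tensor (fun _ : κ => encodingU H θ) * totalHeff κ H θ j) := by
      rw [totalHeff, Finset.mul_sum, Finset.smul_sum]
      exact Finset.sum_congr rfl fun k _ => by rw [tensor_update_smul, tensor_mul_site]
    rw [h2] at h1
    have h3 : (totalHeff κ H θ j)ᴴ = totalHeff κ H θ j := by
      simp [totalHeff, Matrix.conjTranspose_sum, conjTranspose_site, (isHermitian_heff hH θ j).eq]
    have h4 := (h1.mul (HasEntryDerivAt.const (productState ψ))).mul h1.conjTranspose
    simp only [update_eq_self, Matrix.mul_zero, add_zero] at h4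
    have h5 : Complex.I • (tensor (fun _ : κ => encodingU H θ) * totalHeff κ H θ j) *
          productState ψ * (tensor fun _ : κ => encodingU H θ)ᴴ +
        tensor (fun _ : κ => encodingU H θ) * productState ψ *
          (Complex.I • (tensor (fun _ : κ => encodingU H θ) * totalHeff κ H θ j))ᴴ =
        tensor (fun _ : κ => encodingU H θ) *
          (Complex.I • (totalHeff κ H θ j * productState ψ - productState ψ * totalHeff κ H θ j)) *
          (tensor fun _ : κ => encodingU H θ)ᴴ := by
      rw [Matrix.conjTranspose_smul, Matrix.conjTranspose_mul, h3]
      simp only [Complex.star_def, Complex.conj_I, neg_smul, smul_sub, Matrix.mul_smul,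
        Matrix.smul_mul, Matrix.mul_sub, Matrix.sub_mul, Matrix.mul_assoc, Matrix.mul_neg]
      abel
    rw [← h5]
    exact h4

/-- The first term on the right is symmetric in `X` and `Y` by cyclicity, so only the second
contributes to `commMatrix`. -/
theorem trace_mul_commutator_mul_commutator {n : Type*} [Fintype n] {P X Y : Matrix n n ℂ}
    (hP : P * P = P) :
    (P * (X * P - P * X) * (Y * P - P * Y)).trace =
      (P * X * (P * Y)).trace - (P * (X * Y)).trace := by
  have h1 : P * (X * P - P * X) * (Y * P - P * Y) =
      P * X * P * Y * P - P * X * (P * P) * Y - (P * P) * X * Y * P + (P * P) * X * P * Y := by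
    noncomm_ring
  have h2 : (P * X * P * Y * P).trace = (P * X * P * Y).trace := by
    rw [Matrix.trace_mul_comm]
    simp only [← Matrix.mul_assoc, hP]
  have h3 : (P * X * Y * P).trace = (P * X * Y).trace := by
    rw [Matrix.trace_mul_comm]
    simp only [← Matrix.mul_assoc, hP]
  rw [h1, hP, Matrix.trace_add, Matrix.trace_sub, Matrix.trace_sub, h2, h3]
  simp only [← Matrix.mul_assoc]
  ring

/-- With `T_j` the total effective generator and `P` the probe state, the derivative of the state is
`W (i [T_j, P]) Wᴴ`. The unitary `W` cancels in traces, leaving `Tr[P [T_i, T_j]]` with prefactor `4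
/ (2i) = -2i`. -/
theorem commMatrix_productModel (hH : ∀ j, (H j).IsHermitian) (θ : Fin d → ℝ)
    {ψ : κ → EuclideanSpace ℂ (Fin D)} (hψ : ∀ k, ‖ψ k‖ = 1) (i j : Fin d) :
    commMatrix (productModel H ψ) θ i j = -2 * Complex.I * ∑ k, inner ℂ (ψ k)
      (Matrix.toEuclideanLin (heff H θ i * heff H θ j - heff H θ j * heff H θ i) (ψ k)) := by
  have h := isPureModel_productModel hH θ hψ
  set W := tensor (fun _ : κ => encodingU H θ) with hW
  set P := productState ψ with hP
  have hWW : Wᴴ * W = 1 := by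
    rw [hW, conjTranspose_tensor, tensor_mul]
    simp only [conjTranspose_encodingU hH, encodingU_neg_mul, tensor_one]
  have hρ : productModel H ψ θ = W * P * Wᴴ := rfl
  have hconj (A B : Matrix (κ → Fin D) (κ → Fin D) ℂ) :
      (W * P * Wᴴ * (W * A * Wᴴ) * (W * B * Wᴴ)).trace = (P * A * B).trace := by
    have : W * P * Wᴴ * (W * A * Wᴴ) * (W * B * Wᴴ) =
        W * (P * (Wᴴ * W) * A * (Wᴴ * W) * B * Wᴴ) := by simp only [Matrix.mul_assoc]
    rw [this, hWW, Matrix.trace_mul_comm, Matrix.mul_one, Matrix.mul_assoc, hWW, Matrix.mul_one,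
      Matrix.mul_one]
  have htr (i j : Fin d) :
      (productModel H ψ θ * (sld (productModel H ψ) θ i * sld (productModel H ψ) θ j)).trace =
      4 * ((P * (totalHeff κ H θ i * totalHeff κ H θ j)).trace -
        (P * totalHeff κ H θ i * (P * totalHeff κ H θ j)).trace) := by
    have hI (A B : Matrix (κ → Fin D) (κ → Fin D) ℂ) :
        (P * (Complex.I • A) * (Complex.I • B)).trace = -(P * A * B).trace := by
      rw [Matrix.mul_smul, Matrix.mul_smul, Matrix.smul_mul, smul_smul, Complex.I_mul_I,
        neg_one_smul, Matrix.trace_neg]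
    rw [h.trace_mul_sld_mul_sld, hρ, hconj, hI,
      trace_mul_commutator_mul_commutator (productState_mul_self hψ)]
    ring
  rw [commMatrix, Matrix.of_apply, Matrix.mul_sub, Matrix.trace_sub, htr, htr,
    Matrix.trace_mul_comm (P * totalHeff κ H θ j), ← trace_productState_mul_sum_site hψ,
    ← commutator_sum_site, Matrix.mul_sub, Matrix.trace_sub]
  simp only [totalHeff]
  field_simp
  rw [Complex.I_sq]
  ring

theorem productModel_compatible (hd : d ≠ 0) (hH : ∀ j, (H j).IsHermitian) (θ : Fin d → ℝ)
    {ψ : κ → EuclideanSpace ℂ (Fin D)} (hψ : ∀ k, ‖ψ k‖ = 1)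
    (h0 : ∀ i j, ∑ k, inner ℂ (ψ k) (Matrix.toEuclideanLin
      (heff H θ i * heff H θ j - heff H θ j * heff H θ i) (ψ k)) = 0) :
    commMatrix (productModel H ψ) θ = 0 ∧
      ((qfi (productModel H ψ) θ).PosDef → incompatibility (productModel H ψ) θ = 0) := by
  have hA : commMatrix (productModel H ψ) θ = 0 := by
    ext i j
    rw [commMatrix_productModel hH θ hψ, h0, mul_zero, Matrix.zero_apply]
  exact ⟨hA, (isPureModel_productModel hH θ hψ).incompatibility_eq_zero hd hA⟩

end Encoding

/-! ## Anti-parallel probes and orthonormal bases -/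

section Probes

open scoped Matrix

variable {D : ℕ}

/-- The sum is a basis-independent trace, and commutators are traceless. -/
theorem sum_inner_commutator_orthonormalBasis
    (b : OrthonormalBasis (Fin D) ℂ (EuclideanSpace ℂ (Fin D)))
    (X Y : Matrix (Fin D) (Fin D) ℂ) :
    ∑ k, inner ℂ (b k) (Matrix.toEuclideanLin (X * Y - Y * X) (b k)) = 0 := by
  have h (C : Matrix (Fin D) (Fin D) ℂ) :
      ∑ k, inner ℂ (b k) (Matrix.toEuclideanLin C (b k)) = C.trace := by
    rw [← LinearMap.trace_eq_sum_inner _ b,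
      LinearMap.trace_eq_sum_inner _ (EuclideanSpace.basisFun (Fin D) ℂ)]
    simp [Matrix.trace, EuclideanSpace.inner_single_left, Matrix.toLpLin_apply]
  rw [h, Matrix.trace_sub, Matrix.trace_mul_comm, sub_self]

theorem inner_toEuclideanLin_of_conjTranspose_eq_neg {C : Matrix (Fin D) (Fin D) ℂ}
    (hC : Cᴴ = -C) (x y : EuclideanSpace ℂ (Fin D)) :
    inner ℂ (Matrix.toEuclideanLin C x) y = -inner ℂ x (Matrix.toEuclideanLin C y) := by
  rw [← LinearMap.adjoint_inner_right, ← Matrix.toEuclideanLin_conjTranspose_eq_adjoint, hC,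
    map_neg, LinearMap.neg_apply, inner_neg_right]

theorem inner_eq_zero_of_eigenvector_of_mem_ker {C : Matrix (Fin D) (Fin D) ℂ}
    (hC : Cᴴ = -C) {x ν : EuclideanSpace ℂ (Fin D)} {c : ℂ} (hc : c ≠ 0)
    (hx : Matrix.toEuclideanLin C x = c • x) (hν : Matrix.toEuclideanLin C ν = 0) :
    inner ℂ x ν = 0 := by
  have h := inner_toEuclideanLin_of_conjTranspose_eq_neg hC x ν
  rw [hx, hν, inner_zero_right, neg_zero, inner_smul_left] at h
  exact (mul_eq_zero.1 h).resolve_left ((map_ne_zero _).2 hc)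

variable {m : ℕ} {C : Matrix (Fin D) (Fin D) ℂ} {a : Fin m → ℝ}
  {v : Fin m → Fin 2 → EuclideanSpace ℂ (Fin D)}

/-- The kernel of the anti-Hermitian `C` is orthogonal to its eigenvectors with nonzero eigenvalue,
so `ν` affects the expectation only through the normalisation. The phases cancel because the
eigenvectors are orthonormal. -/
theorem norm_antiparallelState (hC : Cᴴ = -C) (ha : ∀ j, 0 < a j)
    (hv : Orthonormal ℂ fun p : Fin m × Fin 2 => v p.1 p.2)
    (hCv : ∀ j (σ : Fin 2), Matrix.toEuclideanLin C (v j σ) =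
      (Complex.I * (-1) ^ (σ : ℕ) * (a j : ℂ)) • v j σ)
    {S : Finset (Fin m)} (hS : S.Nonempty) (s : Fin m → Fin 2) (φ : Fin m → ℝ)
    {ν : EuclideanSpace ℂ (Fin D)} (hν : Matrix.toEuclideanLin C ν = 0) :
    ‖antiparallelState v S s φ ν‖ = 1 ∧
      inner ℂ (antiparallelState v S s φ ν)
        (Matrix.toEuclideanLin C (antiparallelState v S s φ ν)) =
      ((S.card + ‖ν‖ ^ 2 : ℝ) : ℂ)⁻¹ *
        ∑ j ∈ S, Complex.I * (-1) ^ (s j : ℕ) * (a j : ℂ) := by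
  have hpos : (0 : ℝ) < S.card + ‖ν‖ ^ 2 := by
    have : (0 : ℝ) < S.card := by exact_mod_cast hS.card_pos
    positivity
  set r := Real.sqrt (S.card + ‖ν‖ ^ 2) with hr
  have hrr : r * r = S.card + ‖ν‖ ^ 2 := Real.mul_self_sqrt hpos.le
  have hr0 : 0 < r := Real.sqrt_pos.2 hpos
  have hvs : Orthonormal ℂ fun j => v j (s j) :=
    hv.comp (fun j => (j, s j)) fun i j hij => congrArg Prod.fst hij
  have hc (j : Fin m) (σ : Fin 2) : Complex.I * (-1) ^ (σ : ℕ) * (a j : ℂ) ≠ 0 :=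
    mul_ne_zero (mul_ne_zero Complex.I_ne_zero (pow_ne_zero _ (by norm_num)))
      (Complex.ofReal_ne_zero.2 (ha j).ne')
  have hvν (j : Fin m) : inner ℂ (v j (s j)) ν = 0 :=
    inner_eq_zero_of_eigenvector_of_mem_ker hC (hc j (s j)) (hCv j (s j)) hν
  -- Arbitrary coefficients, since this is needed both for `w` and for its image under `C`.
  have hsum (z : Fin m → ℂ) : inner ℂ (∑ j ∈ S, z j • v j (s j)) ν = 0 := by
    rw [sum_inner]
    exact Finset.sum_eq_zero fun j _ => by rw [inner_smul_left, hvν, mul_zero]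
  have hphase (j : Fin m) : (starRingEnd ℂ) (Complex.exp (Complex.I * φ j)) *
      Complex.exp (Complex.I * φ j) = 1 := by
    rw [mul_comm Complex.I, ← Complex.normSq_eq_conj_mul_self, Complex.normSq_eq_norm_sq,
      Complex.norm_exp_ofReal_mul_I]
    simp
  set w := ∑ j ∈ S, Complex.exp (Complex.I * φ j) • v j (s j) with hw
  have hww : inner ℂ w w = (S.card : ℂ) := by
    rw [hw, hvs.inner_sum]
    simp [hphase]
  have hCw : Matrix.toEuclideanLin C w = ∑ j ∈ S, (Complex.exp (Complex.I * φ j) *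
      (Complex.I * (-1) ^ (s j : ℕ) * (a j : ℂ))) • v j (s j) := by
    rw [hw, map_sum]
    exact Finset.sum_congr rfl fun j _ => by rw [map_smul, hCv, smul_smul]
  have hwCw : inner ℂ w (Matrix.toEuclideanLin C w) =
      ∑ j ∈ S, Complex.I * (-1) ^ (s j : ℕ) * (a j : ℂ) := by
    rw [hCw, hw, hvs.inner_sum]
    exact Finset.sum_congr rfl fun j _ => by rw [← mul_assoc, hphase, one_mul]
  have hνCw : inner ℂ ν (Matrix.toEuclideanLin C w) = 0 := by
    rw [hCw, ← inner_conj_symm, hsum, map_zero]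
  have hst : antiparallelState v S s φ ν = (r : ℂ)⁻¹ • (w + ν) := rfl
  have hnorm : ‖w + ν‖ = r := by
    have h1 : ‖w + ν‖ * ‖w + ν‖ = ‖w‖ * ‖w‖ + ‖ν‖ * ‖ν‖ :=
      norm_add_sq_eq_norm_sq_add_norm_sq_of_inner_eq_zero w ν (hsum _)
    have h2 : ‖w‖ * ‖w‖ = S.card := by
      rw [inner_self_eq_norm_sq_to_K] at hww
      have : ‖w‖ ^ 2 = (S.card : ℝ) :=
        Complex.ofReal_injective (by push_cast; exact hww)
      rw [← this, sq]
    rw [h2, ← sq ‖ν‖, ← hrr] at h1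
    exact (mul_self_inj (norm_nonneg _) hr0.le).1 h1
  refine ⟨?_, ?_⟩
  · rw [hst, norm_smul, hnorm, norm_inv, Complex.norm_real, Real.norm_of_nonneg hr0.le,
      inv_mul_cancel₀ hr0.ne']
  · rw [hst, map_smul, map_add, hν, add_zero, inner_smul_left, inner_smul_right, inner_add_left,
      hwCw, hνCw, add_zero, ← mul_assoc, ← hrr, map_inv₀, Complex.conj_ofReal]
    congr 1
    push_cast
    rw [mul_inv]

end Probes

end QEst

end

theorem mainTheorem7 (D : ℕ) :
    -- two parameters: generalized anti-parallel strategy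
    (∀ (H : Fin 2 → Matrix (Fin D) (Fin D) ℂ),
      (∀ j, (H j).IsHermitian) → (∀ j, (H j).trace = 0) →
      ∀ (θ : Fin 2 → ℝ) (C : Matrix (Fin D) (Fin D) ℂ),
      C = QEst.heff H θ 0 * QEst.heff H θ 1 - QEst.heff H θ 1 * QEst.heff H θ 0 →
      ∀ (m : ℕ) (a : Fin m → ℝ) (v : Fin m → Fin 2 → EuclideanSpace ℂ (Fin D)),
      (∀ j, 0 < a j) →
      Orthonormal ℂ (fun p : Fin m × Fin 2 => v p.1 p.2) →
      (∀ j (σ : Fin 2), Matrix.toEuclideanLin C (v j σ) =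
        (Complex.I * (-1) ^ (σ : ℕ) * (a j : ℂ)) • v j σ) →
      ∀ (S : Finset (Fin m)), S.Nonempty →
      ∀ (s : Fin m → Fin 2) (φ₁ φ₂ : Fin m → ℝ) (ν₁ ν₂ : EuclideanSpace ℂ (Fin D)),
      Matrix.toEuclideanLin C ν₁ = 0 → Matrix.toEuclideanLin C ν₂ = 0 → ‖ν₁‖ = ‖ν₂‖ →
      ∀ (ψ : Fin 2 → EuclideanSpace ℂ (Fin D)),
      ψ 0 = QEst.antiparallelState v S s φ₁ ν₁ →
      ψ 1 = QEst.antiparallelState v S (fun j => s j + 1) φ₂ ν₂ →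
      (∀ k, ‖ψ k‖ = 1) ∧
      QEst.commMatrix (QEst.productModel H ψ) θ = 0 ∧
      ((QEst.qfi (QEst.productModel H ψ) θ).PosDef →
        QEst.incompatibility (QEst.productModel H ψ) θ = 0)) ∧
    -- any number of parameters: product of the elements of an orthonormal basis
    (∀ (d : ℕ), 1 ≤ d → ∀ (H : Fin d → Matrix (Fin D) (Fin D) ℂ),
      (∀ j, (H j).IsHermitian) → (∀ j, (H j).trace = 0) →
      ∀ (θ : Fin d → ℝ) (b : OrthonormalBasis (Fin D) ℂ (EuclideanSpace ℂ (Fin D))),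
      QEst.commMatrix (QEst.productModel H (fun k : Fin D => b k)) θ = 0 ∧
      ((QEst.qfi (QEst.productModel H (fun k : Fin D => b k)) θ).PosDef →
        QEst.incompatibility (QEst.productModel H (fun k : Fin D => b k)) θ = 0)) := by
  refine ⟨?_, ?_⟩
  · intro H hH _ θ C hC m a v ha hv hCv S hS s φ₁ φ₂ ν₁ ν₂ hν₁ hν₂ hν ψ hψ₀ hψ₁
    have hCH : C.conjTranspose = -C := by
      rw [hC, Matrix.conjTranspose_sub, Matrix.conjTranspose_mul, Matrix.conjTranspose_mul,
        (QEst.isHermitian_heff hH θ 0).eq, (QEst.isHermitian_heff hH θ 1).eq, neg_sub]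
    obtain ⟨hn₀, hi₀⟩ := QEst.norm_antiparallelState hCH ha hv hCv hS s φ₁ hν₁
    obtain ⟨hn₁, hi₁⟩ := QEst.norm_antiparallelState hCH ha hv hCv hS (fun j => s j + 1) φ₂ hν₂
    rw [← hψ₀] at hn₀ hi₀
    rw [← hψ₁] at hn₁ hi₁
    have hψ : ∀ k, ‖ψ k‖ = 1 := Fin.forall_fin_two.2 ⟨hn₀, hn₁⟩
    -- Addition in `Fin 2` is modulo 2, so `s j + 1` selects the eigenvector of opposite sign.
    have hsign (σ : Fin 2) : (-1 : ℂ) ^ ((σ + 1 : Fin 2) : ℕ) = -(-1) ^ (σ : ℕ) := by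
      fin_cases σ <;> simp
    have hsum : ∑ k, inner ℂ (ψ k) (Matrix.toEuclideanLin C (ψ k)) = 0 := by
      rw [Fin.sum_univ_two, hi₀, hi₁, hν, ← mul_add, ← Finset.sum_add_distrib]
      simp [hsign]
    refine ⟨hψ, QEst.productModel_compatible two_ne_zero hH θ hψ ?_⟩
    have hneg : QEst.heff H θ 1 * QEst.heff H θ 0 - QEst.heff H θ 0 * QEst.heff H θ 1 = -C := by
      rw [hC, neg_sub]
    refine Fin.forall_fin_two.2 ⟨Fin.forall_fin_two.2 ⟨?_, ?_⟩, Fin.forall_fin_two.2 ⟨?_, ?_⟩⟩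
    · simp
    · rw [← hC, hsum]
    · simp only [hneg, map_neg, LinearMap.neg_apply, inner_neg_right, Finset.sum_neg_distrib,
        hsum, neg_zero]
    · simp
  · intro d hd H hH _ θ b
    exact QEst.productModel_compatible (Nat.one_le_iff_ne_zero.1 hd) hH θ b.norm_eq_one
      fun i j => QEst.sum_inner_commutator_orthonormalBasis b _ _
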